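/- Let $E$ be a metric space with its Borel $\sigma$-algebra, and let $(X^{(n)}(\cdot),T_n)$, $n\ge 1$, be i.i.d. random elements on a probability space, where $X^{(n)}=(X^{(n)}(s))_{s\ge 0}$ is an $E$-valued process with almost surely right-continuous sample paths and $T_n$ is an almost surely nonnegative random variable; $X^{(n)}$ and $T_n$ may depend on each other in any way. Put $S_0=0$, $S_n=T_1+\dots+T_n$, $N(t)=\sup\{n\ge 0: S_n\le t\}$, and let \[X(t)=X^{(N(t)+1)}\bigl(t-S_{N(t)}\bigr),\qquad t\ge 0,\] be the regenerative process with these cycles and cycle lengths. Suppose that $T_1$ has finite positive mean and a nonarithmetic distribution, i.e. for no $d>0$ is it concentrated on $\{kd: k\in\mathbb Z\}$. Let $\alpha_1,\dots,\alpha_m>0$ be pairwise distinct and $\beta_1,\dots,\beta_m\in\mathbb R$. Then $X(\alpha_1t+\beta_1),\dots,X(\alpha_mt+\beta_m)$ are asymptotically independent and identically distributed as $t\to\infty$: there is a probability measure $\nu$ on $E$ such that, for all bounded continuous $f_1,\dots,f_m:E\to\mathbb R$, \[\lim_{t\to\infty}\mathbb E\prod_{i=1}^m f_i\bigl(X(\alpha_it+\beta_i)\bigr)=\prod_{i=1}^m\int_E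 f_i\,d\nu ,\] and, if $E$ is separable, the vector $(X(\alpha_1t+\beta_1),\dots,X(\alpha_mt+\beta_m))$ converges in distribution in $E^m$ to the product measure $\nu^{\otimes m}$, i.e. to a vector of independent random variables with common law $\nu$. -/

import Mathlib

open MeasureTheory ProbabilityTheory Filter
open scoped NNReal Topology BoundedContinuousFunction

/-- A law on `ℝ` is arithmetic if it is concentrated on `{k * d | k ∈ ℤ}` for some `d > 0`. -/
def IsArithmetic (ν : Measure ℝ) : Prop :=
  ∃ d : ℝ, 0 < d ∧ ∀ᵐ x ∂ν, ∃ k : ℤ, x = k * d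

section Regenerative

variable {Ω E : Type*}

/-- The regeneration epochs `S 0 = 0`, `S n = T 0 + ⋯ + T (n - 1)`: the first cycle has index `0`
and length `T 0`. -/
def regenEpoch (T : ℕ → Ω → ℝ) (n : ℕ) (ω : Ω) : ℝ :=
  ∑ k ∈ Finset.range n, T k ω

/-- The counting process `N t = sup {n | S n ≤ t}`. -/
noncomputable def regenCount (T : ℕ → Ω → ℝ) (t : ℝ≥0) (ω : Ω) : ℕ :=
  sSup {n : ℕ | regenEpoch T n ω ≤ t}

/-- The path obtained by running the cycles one after another: at time `t` the cycle with index
`N t` is in progress, since time `S (N t)`. -/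
noncomputable def regenPath (C : ℕ → ℝ≥0 → Ω → E) (T : ℕ → Ω → ℝ) (t : ℝ≥0) (ω : Ω) : E :=
  C (regenCount T t ω) ((t : ℝ) - regenEpoch T (regenCount T t ω) ω).toNNReal ω

variable [MeasurableSpace Ω] [MetricSpace E] [MeasurableSpace E]

/-- `X` is a regenerative process with cycles `C n` and cycle lengths `T n`: the pairs
`(C n, T n)` of a path and a length are i.i.d. random elements (the path and the length of one
cycle may depend on each other in any way), lengths are a.s. nonnegative, cycles are a.s. right
continuous, and `X` is a.s. the concatenation of its cycles. -/
structure IsRegenerative (P : Measure Ω) (X : ℝ≥0 → Ω → E)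
    (C : ℕ → ℝ≥0 → Ω → E) (T : ℕ → Ω → ℝ) : Prop where
  measurable_cycle : ∀ n s, Measurable (C n s)
  measurable_length : ∀ n, Measurable (T n)
  indep : iIndepFun (fun n ω ↦ ((fun s ↦ C n s ω : ℝ≥0 → E), T n ω)) P
  identDistrib : ∀ n, IdentDistrib (fun ω ↦ ((fun s ↦ C n s ω : ℝ≥0 → E), T n ω))
    (fun ω ↦ ((fun s ↦ C 0 s ω : ℝ≥0 → E), T 0 ω)) P P
  length_nonneg : ∀ n, ∀ᵐ ω ∂P, 0 ≤ T n ω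
  rightContinuous : ∀ n, ∀ᵐ ω ∂P, ∀ s, ContinuousWithinAt (fun u ↦ C n u ω) (Set.Ici s) s
  eq_path : ∀ᵐ ω ∂P, ∀ t, X t ω = regenPath C T t ω

/-- The processes `Y 0, …, Y (m - 1)` are asymptotically independent and identically distributed:
for some probability measure `ν` on `E`, `(Y 0 t, …, Y (m - 1) t)` converges jointly in
distribution, as `t → ∞`, to a vector of independent random variables with common law `ν`.

On every metric space this is expressed by products of bounded continuous functions of the
coordinates. If `E` is separable, so that the Borel `σ`-algebra of `E ^ m` is the product one, it is
also required as convergence in distribution in the space `E ^ m`. -/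
def AsymptoticallyIID [BorelSpace E] (P : Measure Ω) [IsProbabilityMeasure P] {m : ℕ}
    (Y : Fin m → ℝ → Ω → E) : Prop :=
  ∃ ν : Measure E, ∃ _ : IsProbabilityMeasure ν,
    (∀ i t, AEMeasurable (Y i t) P) ∧
    (∀ f : Fin m → E →ᵇ ℝ,
      Tendsto (fun t ↦ ∫ ω, ∏ i, f i (Y i t ω) ∂P) atTop (𝓝 (∏ i, ∫ x, f i x ∂ν))) ∧
    (∀ [SecondCountableTopology E],
      TendstoInDistribution (fun (t : ℝ) (ω : Ω) (i : Fin m) ↦ Y i t ω) atTop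
        (id : (Fin m → E) → Fin m → E) (fun _ ↦ P) (Measure.pi fun _ ↦ ν))

end Regenerative

/-!
Write `τ` for the length of a cycle. The mean `Z t` at time `t` of a bounded functional of the
process satisfies, by conditioning on the first cycle, the renewal equation
`Z t = z t + E Z (t - τ)`, where `z t` is the contribution of the event `t < τ`.

*Averages converge.* Let `V t` be the average of `Z` over `[t, t + h]`. It is bounded and Lipschitz,
and `V t - E V (t - τ) → 0`. Integrating the renewal equation over `[0, t]` produces a conserved
quantity: `∫ Z (t - y) P (y < τ) dy = ∫₀ᵗ z`. If `V` is close to its upper limit `M` at a large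
time `t`, it is so at `t - y` for `y` in the support of the law of `τ`, hence for `y` in the
additive monoid generated by this support. The law being nonarithmetic, this monoid gets arbitrarily
close to every large number, so that along some sequence `V (t - y)` is almost `M` for all large
`y`, and the conserved quantity bounds `M` by `∫ z / E τ`. The same for `-V` gives `V → ∫ z / E τ`
(`tendsto_of_conserved`, `tendsto_average_of_renewal`).

*One time.* The age, i.e. the time since the last renewal, grows at most at unit speed, which
sandwiches its distribution function between averages: the age converges in distribution to the
stationary age, whose density is `P (y < τ) / E τ` (`tendsto_measureReal_age_lt`). By uniqueness for
the renewal equation, the mean of any bounded functional is that of the function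
`z y / P (y < τ)` of the age. The paths being right continuous, so is this function; it therefore
has at most countably many discontinuities, and its means converge (`tendsto_cycleMean`).
This avoids any discussion of direct Riemann integrability.

*Several times.* By induction on the number of times, the last factors having almost the right mean
from any late renewal on, the dependence between the first factor and the others is bounded by the
probability that the cycle in progress at the first time lasts very long, which is small because the
age is tight. The comparison is made through the renewal equation again
(`abs_cycleMean_le_cycleMean`, `exists_forall_abs_integral_prod_sub_le`). The times `αᵢ t + βᵢ` tend
to infinity and, the `αᵢ` being distinct, so do their distances.

Two technical points: the `σ`-algebra on paths is the product one, for which evaluation at a random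
time is measurable only after being rewritten as an upper limit along countably many times
(`pathKernel`); and in a separable space, convergence of the means of products is upgraded to weak
convergence with the `π`-system of boxes whose sides have null boundary
(`tendsto_pi_of_tendsto_integral_prod`).
-/

/-! ### Submonoids of the half-line -/

/-- An additive monoid of nonnegative numbers which is not contained in any lattice `d ℤ` gets
arbitrarily close to every large number. -/
theorem exists_mem_near_of_not_arithmetic (A : AddSubmonoid ℝ) (hA : ∀ a ∈ A, 0 ≤ a)
    (hd : ∀ d : ℝ, 0 < d → ¬ ∀ a ∈ A, ∃ k : ℤ, a = k * d) {δ : ℝ} (hδ : 0 < δ) :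
    ∃ Y : ℝ, ∀ y ≥ Y, ∃ a ∈ A, |y - a| ≤ δ := by
  -- the differences of elements of `A` form a dense subgroup
  let H : AddSubgroup ℝ :=
    { carrier := {x | ∃ a ∈ A, ∃ b ∈ A, x = a - b}
      zero_mem' := ⟨0, A.zero_mem, 0, A.zero_mem, by simp⟩
      add_mem' := by
        rintro _ _ ⟨a, ha, b, hb, rfl⟩ ⟨a', ha', b', hb', rfl⟩
        exact ⟨a + a', A.add_mem ha ha', b + b', A.add_mem hb hb', by ring⟩
      neg_mem' := by
        rintro _ ⟨a, ha, b, hb, rfl⟩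
        exact ⟨b, hb, a, ha, by ring⟩ }
  have hAH : ∀ a ∈ A, a ∈ H := fun a ha ↦ ⟨a, ha, 0, A.zero_mem, by simp⟩
  have hdense : Dense (H : Set ℝ) := by
    refine H.dense_or_cyclic.resolve_right ?_
    rintro ⟨g, hg⟩
    by_cases hg0 : g = 0
    · refine hd 1 one_pos fun a ha ↦ ⟨0, ?_⟩
      have := hAH a ha
      rw [hg, AddSubgroup.mem_closure_singleton] at this
      obtain ⟨k, hk⟩ := this
      simp [← hk, hg0]
    · refine hd |g| (abs_pos.2 hg0) fun a ha ↦ ?_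
      have := hAH a ha
      rw [hg, AddSubgroup.mem_closure_singleton] at this
      obtain ⟨k, hk⟩ := this
      rcases abs_choice g with h | h
      · exact ⟨k, by rw [h, ← hk, zsmul_eq_mul]⟩
      · exact ⟨-k, by rw [h, ← hk, zsmul_eq_mul]; push_cast; ring⟩
  obtain ⟨_, ⟨a, ha, b, hb, rfl⟩, h0, h1⟩ := hdense.exists_between hδ
  set η := a - b with hη
  rcases (hA b hb).eq_or_lt with hb0 | hb0
  · -- multiples of `a = η`
    refine ⟨0, fun y hy ↦ ⟨⌊y / η⌋₊ • a, A.nsmul_mem ha _, ?_⟩⟩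
    have ha' : a = η := by rw [hη, ← hb0, sub_zero]
    have e1 := Nat.floor_le (div_nonneg hy h0.le)
    have e2 := Nat.lt_floor_add_one (y / η)
    rw [le_div_iff₀ h0] at e1
    rw [div_lt_iff₀ h0] at e2
    rw [nsmul_eq_mul, ha', abs_le]
    constructor <;> nlinarith
  · -- `n b + i η = i a + (n - i) b` with `i ≤ n`
    refine ⟨(⌈b / η⌉₊ + 1 : ℕ) * b, fun y hy ↦ ?_⟩
    have hy0 : 0 ≤ y := le_trans (by positivity) hy
    set n := ⌊y / b⌋₊ with hn
    have e1 := Nat.floor_le (div_nonneg hy0 hb0.le)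
    have e2 := Nat.lt_floor_add_one (y / b)
    rw [← hn, le_div_iff₀ hb0] at e1
    rw [← hn, div_lt_iff₀ hb0] at e2
    have hr0 : 0 ≤ y - n * b := by linarith
    set i := ⌊(y - n * b) / η⌋₊ with hi
    have f1 := Nat.floor_le (div_nonneg hr0 h0.le)
    have f2 := Nat.lt_floor_add_one ((y - n * b) / η)
    rw [← hi, le_div_iff₀ h0] at f1
    rw [← hi, div_lt_iff₀ h0] at f2
    have hin : i ≤ n := by
      have g1 : i ≤ ⌈b / η⌉₊ := by
        have : (i : ℝ) ≤ b / η := by rw [le_div_iff₀ h0]; nlinarith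
        exact_mod_cast this.trans (Nat.le_ceil _)
      have g2 : ⌈b / η⌉₊ + 1 ≤ n := by
        rw [hn]; exact Nat.le_floor (by rw [le_div_iff₀ hb0]; exact hy)
      omega
    refine ⟨i • a + (n - i) • b, A.add_mem (A.nsmul_mem ha _) (A.nsmul_mem hb _), ?_⟩
    have : i • a + (n - i) • b = n * b + i * η := by
      rw [nsmul_eq_mul, nsmul_eq_mul, Nat.cast_sub hin, hη]; ring
    rw [this, abs_le]
    constructor <;> nlinarith

/-! ### The renewal theorem for Lipschitz functions -/

section Feller

variable {S : Type*} [MeasurableSpace S] {Q : Measure S} [IsProbabilityMeasure Q] {τ : S → ℝ}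

/-- `y` is a good shift for `V` at level `M` if `V (t - y)` is almost at least `M` whenever `V t`
is, for large `t`. -/
def IsGoodShift (V : ℝ → ℝ) (M y : ℝ) : Prop :=
  ∀ ε > 0, ∃ δ > 0, ∀ᶠ t in atTop, M - δ ≤ V t → M - ε ≤ V (t - y)

theorem IsGoodShift.add {V : ℝ → ℝ} {M x y : ℝ} (hx : IsGoodShift V M x)
    (hy : IsGoodShift V M y) : IsGoodShift V M (x + y) := by
  intro ε hε
  obtain ⟨δ, hδ, h1⟩ := hy ε hε
  obtain ⟨δ', hδ', h2⟩ := hx δ hδ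
  refine ⟨δ', hδ', ?_⟩
  have h3 := (tendsto_atTop_add_const_right atTop (-x) tendsto_id).eventually h1
  filter_upwards [h2, h3] with t ht1 ht2 h
  have := ht2 (by simpa [sub_eq_add_neg] using ht1 h)
  convert this using 2
  simp; ring

/-- The good shifts form an additive monoid. -/
def goodShifts (V : ℝ → ℝ) (M : ℝ) : AddSubmonoid ℝ where
  carrier := {y | IsGoodShift V M y}
  zero_mem' := fun ε hε ↦ ⟨ε, hε, by simp⟩
  add_mem' := fun hx hy ↦ IsGoodShift.add hx hy

theorem tendsto_measureReal_lt (hτ : Measurable τ) :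
    Tendsto (fun t ↦ Q.real {s | t < τ s}) atTop (𝓝 0) := by
  have h : Tendsto (fun t ↦ ∫ s, Set.indicator {s | t < τ s} 1 s ∂Q) atTop
      (𝓝 (∫ _, (0 : ℝ) ∂Q)) := by
    refine tendsto_integral_filter_of_dominated_convergence (fun _ ↦ 1) ?_ ?_
      (integrable_const _) ?_
    · exact .of_forall fun t ↦ (measurable_one.indicator
        (measurableSet_lt measurable_const hτ)).aestronglyMeasurable
    · refine .of_forall fun t ↦ .of_forall fun s ↦ ?_
      by_cases h : t < τ s <;> simp [h]
    · refine .of_forall fun s ↦ tendsto_const_nhds.congr' ?_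
      filter_upwards [eventually_ge_atTop (τ s)] with t ht
      rw [Set.indicator_of_notMem]
      simpa using ht
  simp only [integral_zero] at h
  refine h.congr fun t ↦ ?_
  rw [integral_indicator_one (measurableSet_lt measurable_const hτ)]

/-- Every point of the support of the law of `τ` is a good shift at the level of the upper limit. -/
theorem isGoodShift_of_mem_support (hτ : Measurable τ) {V : ℝ → ℝ} {K : ℝ≥0}
    (hV : LipschitzWith K V) {b : ℝ} (hb : ∀ t, |V t| ≤ b) {M : ℝ}
    (hM : ∀ ε > 0, ∀ᶠ t in atTop, V t ≤ M + ε)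
    (hv : Tendsto (fun t ↦ V t - ∫ s, V (t - τ s) ∂Q) atTop (𝓝 0)) {y : ℝ}
    (hy : ∀ ρ > 0, 0 < Q.real {s | |τ s - y| < ρ}) : IsGoodShift V M y := by
  intro ε hε
  -- on `|τ - y| < ρ`, the values of `V` at `t - τ` and `t - y` differ by at most `ε / 2`
  set ρ := ε / (2 * (K + 1)) with hρ
  have hρ0 : 0 < ρ := by positivity
  have hKρ : K * ρ ≤ ε / 2 := by
    rw [hρ, mul_div_assoc', div_le_div_iff₀ (by positivity) (by positivity)]
    nlinarith [K.2]
  set p := Q.real {s | |τ s - y| < ρ} with hp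
  have hp0 : 0 < p := hy ρ hρ0
  have hpε : 0 < p * ε := mul_pos hp0 hε
  -- a deficit of `ε` at `t - y` costs `p * ε / 2` in the mean, more than the other errors, which
  -- are at most `δ` each
  set δ := p * ε / 16 with hδ
  have hδ0 : 0 < δ := by positivity
  obtain ⟨a, ha⟩ := eventually_atTop.1 (hM δ hδ0)
  have hb0 : 0 ≤ b := (abs_nonneg _).trans (hb 0)
  set B := |M| + b + ε with hBdef
  have hB : 0 < B := by positivity
  have hq := ((tendsto_measureReal_lt (Q := Q) hτ).comp
    (tendsto_atTop_add_const_right atTop (-a) tendsto_id)).eventually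
    (gt_mem_nhds (show 0 < δ / B by positivity))
  refine ⟨δ, hδ0, ?_⟩
  filter_upwards [hq, hv.eventually (gt_mem_nhds hδ0)] with t ht1 ht2 hVt
  by_contra! hcon
  rw [lt_div_iff₀ hB] at ht1
  simp only [Function.comp_apply, id] at ht1
  have hmeas : Measurable fun s ↦ V (t - τ s) :=
    hV.continuous.measurable.comp (measurable_const.sub hτ)
  have hint : Integrable (fun s ↦ V (t - τ s)) Q :=
    Integrable.of_bound hmeas.aestronglyMeasurable b (.of_forall fun s ↦ hb _)
  have m1 : MeasurableSet {s | |τ s - y| < ρ} :=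
    measurableSet_lt ((hτ.sub_const y).norm) measurable_const
  have m2 : MeasurableSet {s | t + -a < τ s} := measurableSet_lt measurable_const hτ
  have hpt : ∀ s, Set.indicator {s | |τ s - y| < ρ} (fun _ ↦ ε / 2) s -
      Set.indicator {s | t + -a < τ s} (fun _ ↦ B) s ≤ M + δ - V (t - τ s) := by
    intro s
    have hVs := (abs_le.1 (hb (t - τ s)))
    have hMa := abs_le.1 (le_refl |M|)
    by_cases h2 : t + -a < τ s
    · have : Set.indicator {s | |τ s - y| < ρ} (fun _ ↦ ε / 2) s ≤ ε / 2 :=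
        Set.indicator_le_self' (fun _ _ ↦ by positivity) s
      rw [Set.indicator_of_mem (s := {s | t + -a < τ s}) h2]
      linarith
    · rw [Set.indicator_of_notMem (s := {s | t + -a < τ s}) h2]
      have hVM := ha (t - τ s) (by linarith [not_lt.1 h2])
      by_cases h1 : |τ s - y| < ρ
      · rw [Set.indicator_of_mem (s := {s | |τ s - y| < ρ}) h1]
        have := hV.dist_le_mul (t - τ s) (t - y)
        rw [Real.dist_eq, Real.dist_eq, show t - τ s - (t - y) = -(τ s - y) by ring,
          abs_neg] at this
        have h3 := (abs_le.1 this).2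
        have : K * |τ s - y| ≤ K * ρ := by gcongr
        linarith
      · rw [Set.indicator_of_notMem (s := {s | |τ s - y| < ρ}) h1]
        linarith
  have hI := integral_mono (((integrable_const _).indicator m1).sub
    ((integrable_const _).indicator m2)) ((integrable_const (M + δ)).sub hint) hpt
  rw [integral_sub' ((integrable_const _).indicator m1) ((integrable_const _).indicator m2),
    integral_sub' (integrable_const _) hint, integral_indicator_const _ m1,
    integral_indicator_const _ m2, integral_const, probReal_univ] at hI
  simp only [smul_eq_mul, one_mul] at hI
  change p * (ε / 2) - _ ≤ _ at hI
  have hδp : δ * 16 = p * ε := by rw [hδ]; ring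
  linarith

/-- A lower bound on the conserved quantity: if `V` keeps returning near its upper limit `M`, then
`M` times the mass of `κ` is at most the limit of the averages of `V` against `κ`. -/
theorem mul_le_of_conserved (hτ : Measurable τ) (hτ0 : ∀ᵐ s ∂Q, 0 ≤ τ s)
    (hna : ∀ d : ℝ, 0 < d → ¬ ∀ᵐ s ∂Q, ∃ k : ℤ, τ s = k * d)
    {V : ℝ → ℝ} {K : ℝ≥0}
    (hV : LipschitzWith K V) {b : ℝ} (hb : ∀ t, |V t| ≤ b) {M : ℝ}
    (hM : ∀ ε > 0, ∀ᶠ t in atTop, V t ≤ M + ε)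
    (hM' : ∀ ε > 0, ∃ᶠ t in atTop, M - ε ≤ V t)
    (hv : Tendsto (fun t ↦ V t - ∫ s, V (t - τ s) ∂Q) atTop (𝓝 0))
    {κ : Measure ℝ} [IsFiniteMeasure κ] (hκ : ∀ᵐ y ∂κ, 0 ≤ y) {ζ : ℝ}
    (hζ : Tendsto (fun t ↦ ∫ y, V (t - y) ∂κ) atTop (𝓝 ζ)) :
    M * κ.real Set.univ ≤ ζ := by
  -- a sequence along which `V` tends to its upper limit
  have hseq : ∀ k : ℕ, ∃ t : ℝ, (k : ℝ) ≤ t ∧ M - 1 / ((k : ℝ) + 1) ≤ V t := fun k ↦ by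
    obtain ⟨t, h1, h2⟩ := ((hM' (1 / ((k : ℝ) + 1)) (by positivity)).and_eventually
      (eventually_ge_atTop (k : ℝ))).exists
    exact ⟨t, h2, h1⟩
  choose t ht1 ht2 using hseq
  have ht : Tendsto t atTop atTop := tendsto_atTop_mono ht1 tendsto_natCast_atTop_atTop
  have hgood : ∀ y, IsGoodShift V M y → ∀ ε > 0, ∀ᶠ k in atTop, M - ε ≤ V (t k - y) := by
    intro y hy ε hε
    obtain ⟨δ, hδ, h⟩ := hy ε hε
    have h0 := tendsto_one_div_add_atTop_nhds_zero_nat (𝕜 := ℝ)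
    filter_upwards [ht.eventually h, h0.eventually (gt_mem_nhds hδ)] with k hk1 hk2
    exact hk1 (by linarith [ht2 k])
  -- the monoid generated by the support of the law of `τ`
  set F := Q.map τ with hF
  have : IsProbabilityMeasure F := Measure.isProbabilityMeasure_map hτ.aemeasurable
  set A := AddSubmonoid.closure F.support with hA
  have hsupp : ∀ y ∈ F.support, IsGoodShift V M y := by
    intro y hy
    refine isGoodShift_of_mem_support hτ hV hb hM hv fun ρ hρ ↦ ?_
    rw [Measure.mem_support_iff_forall] at hy
    have := hy _ (Metric.ball_mem_nhds y hρ)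
    rw [hF, Measure.map_apply hτ measurableSet_ball] at this
    rw [measureReal_def, ENNReal.toReal_pos_iff]
    exact ⟨this, measure_lt_top _ _⟩
  have hAgood : ∀ y ∈ A, IsGoodShift V M y := fun y hy ↦ by
    have : A ≤ goodShifts V M := by
      rw [hA, AddSubmonoid.closure_le]; exact hsupp
    exact this hy
  have hF0 : F.support ⊆ Set.Ici 0 := by
    refine Measure.support_subset_of_isClosed isClosed_Ici ?_
    exact (ae_map_iff hτ.aemeasurable measurableSet_Ici).2 hτ0
  have hA0 : ∀ a ∈ A, 0 ≤ a := fun a ha ↦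
    (AddSubmonoid.closure_le (S := AddSubmonoid.nonneg ℝ)).2 hF0 ha
  have hAd : ∀ d : ℝ, 0 < d → ¬ ∀ a ∈ A, ∃ k : ℤ, a = k * d := fun d hd0 h ↦ by
    refine hna d hd0 ?_
    have h1 : ∀ᵐ y ∂F, y ∈ F.support := Measure.support_mem_ae
    filter_upwards [ae_of_ae_map hτ.aemeasurable h1] with s hs
    exact h _ (AddSubmonoid.subset_closure hs)
  -- `V (t k - y)` is eventually above `M - (δ + K * δ)` for every `y ≥ Y`, and `κ` sits on the
  -- half-line: translate by `Y` and pass to the limit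
  have key : ∀ δ > 0, (M - (δ + K * δ)) * κ.real Set.univ ≤ ζ := by
    intro δ hδ
    obtain ⟨Y, hY⟩ := exists_mem_near_of_not_arithmetic A hA0 hAd hδ
    set c := M - (δ + K * δ) with hc
    have hlow : ∀ y ≥ Y, ∀ᶠ k in atTop, c ≤ V (t k - y) := by
      intro y hy
      obtain ⟨a, ha, hya⟩ := hY y hy
      filter_upwards [hgood a (hAgood a ha) δ hδ] with k hk
      have := hV.dist_le_mul (t k - a) (t k - y)
      rw [Real.dist_eq, Real.dist_eq, show t k - a - (t k - y) = y - a by ring] at this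
      have h3 := (abs_le.1 this).2
      have : K * |y - a| ≤ K * δ := by gcongr
      rw [hc]; linarith
    have hm : ∀ k, Measurable fun y ↦ V (t k - Y - y) := fun k ↦
      hV.continuous.measurable.comp (measurable_const.sub measurable_id)
    -- truncated at `c`, the integrands are eventually equal to `c`
    have hlim : Tendsto (fun k ↦ ∫ y, min (V (t k - Y - y)) c ∂κ) atTop (𝓝 (∫ _, c ∂κ)) := by
      refine tendsto_integral_of_dominated_convergence (fun _ ↦ b + |c|) ?_
        (integrable_const _) ?_ ?_
      · exact fun k ↦ ((hm k).min measurable_const).aestronglyMeasurable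
      · refine fun k ↦ .of_forall fun y ↦ ?_
        have h1 := abs_le.1 (hb (t k - Y - y))
        have h2 := abs_le.1 (le_refl |c|)
        have h3 := abs_nonneg c
        rw [Real.norm_eq_abs, abs_le]
        constructor
        · exact le_min (by linarith) (by linarith)
        · exact (min_le_left _ _).trans (by linarith)
      · filter_upwards [hκ] with y hy
        refine tendsto_const_nhds.congr' ?_
        filter_upwards [hlow (Y + y) (by linarith)] with k hk
        rw [min_eq_right]
        rwa [sub_sub]
    have hub := hζ.comp (tendsto_atTop_add_const_right atTop (-Y) ht)
    rw [integral_const, smul_eq_mul, mul_comm] at hlim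
    refine le_of_tendsto_of_tendsto' hlim hub fun k ↦ ?_
    simp only [Function.comp_apply, ← sub_eq_add_neg]
    refine integral_mono ?_ ?_ fun y ↦ min_le_left _ _
    · refine Integrable.of_bound ((hm k).min measurable_const).aestronglyMeasurable (b + |c|)
        (.of_forall fun y ↦ ?_)
      have h1 := abs_le.1 (hb (t k - Y - y))
      have h2 := abs_le.1 (le_refl |c|)
      have h3 := abs_nonneg c
      rw [Real.norm_eq_abs, abs_le]
      constructor
      · exact le_min (by linarith) (by linarith)
      · exact (min_le_left _ _).trans (by linarith)
    · exact Integrable.of_bound (hm k).aestronglyMeasurable b (.of_forall fun y ↦ hb _)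
  have hl : Tendsto (fun δ : ℝ ↦ (M - (δ + K * δ)) * κ.real Set.univ) (𝓝[>] 0)
      (𝓝 ((M - (0 + K * 0)) * κ.real Set.univ)) :=
    (Continuous.tendsto (by fun_prop) 0).mono_left nhdsWithin_le_nhds
  simp only [mul_zero, add_zero, sub_zero] at hl
  exact le_of_tendsto hl (eventually_mem_nhdsWithin.mono fun δ hδ ↦ key δ hδ)

/-- **Renewal theorem for Lipschitz functions**: a bounded Lipschitz function which asymptotically
solves `V t = E V (t - τ)` converges, as soon as its averages against some measure on the half-line
do. The averages determine the limit, by bounding both the upper and the lower limit of `V`. -/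
theorem tendsto_of_conserved (hτ : Measurable τ) (hτ0 : ∀ᵐ s ∂Q, 0 ≤ τ s)
    (hna : ∀ d : ℝ, 0 < d → ¬ ∀ᵐ s ∂Q, ∃ k : ℤ, τ s = k * d)
    {V : ℝ → ℝ} {K : ℝ≥0} (hV : LipschitzWith K V) {b : ℝ} (hb : ∀ t, |V t| ≤ b)
    (hv : Tendsto (fun t ↦ V t - ∫ s, V (t - τ s) ∂Q) atTop (𝓝 0))
    {κ : Measure ℝ} [IsFiniteMeasure κ] (hκ : ∀ᵐ y ∂κ, 0 ≤ y) (hκ0 : 0 < κ.real Set.univ) {ζ : ℝ}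
    (hζ : Tendsto (fun t ↦ ∫ y, V (t - y) ∂κ) atTop (𝓝 ζ)) :
    Tendsto V atTop (𝓝 (ζ / κ.real Set.univ)) := by
  have hbd : ∀ W : ℝ → ℝ, (∀ t, |W t| ≤ b) → IsBoundedUnder (· ≤ ·) atTop W ∧
      IsBoundedUnder (· ≥ ·) atTop W := fun W hW ↦
    ⟨isBoundedUnder_of ⟨b, fun t ↦ (abs_le.1 (hW t)).2⟩,
      isBoundedUnder_of ⟨-b, fun t ↦ (abs_le.1 (hW t)).1⟩⟩
  have main : ∀ (W : ℝ → ℝ) (z : ℝ), LipschitzWith K W → (∀ t, |W t| ≤ b) →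
      Tendsto (fun t ↦ W t - ∫ s, W (t - τ s) ∂Q) atTop (𝓝 0) →
      Tendsto (fun t ↦ ∫ y, W (t - y) ∂κ) atTop (𝓝 z) →
      limsup W atTop ≤ z / κ.real Set.univ := by
    intro W z hW hWb hWv hWz
    obtain ⟨h1, h2⟩ := hbd W hWb
    rw [le_div_iff₀ hκ0]
    refine mul_le_of_conserved hτ hτ0 hna hW hWb (fun ε hε ↦ ?_) (fun ε hε ↦ ?_) hWv hκ hWz
    · exact (eventually_lt_of_limsup_lt (lt_add_of_pos_right _ hε) h1).mono fun _ h ↦ h.le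
    · exact (frequently_lt_of_lt_limsup h2.isCoboundedUnder_le (sub_lt_self _ hε)).mono
        fun _ h ↦ h.le
  have hup := main V ζ hV hb hv hζ
  have hlo := main (fun t ↦ -V t) (-ζ) hV.neg (fun t ↦ by rw [abs_neg]; exact hb t)
    (by simpa [integral_neg, sub_eq_add_neg, add_comm] using hv.neg)
    (by simpa [integral_neg] using hζ.neg)
  obtain ⟨h1, h2⟩ := hbd V hb
  refine tendsto_of_le_liminf_of_limsup_le ?_ hup h1 h2
  obtain ⟨h3, h4⟩ := hbd (fun t ↦ -V t) (fun t ↦ by rw [abs_neg]; exact hb t)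
  refine le_of_forall_lt fun a ha ↦ ?_
  have hlt : limsup (fun t ↦ -V t) atTop < -a := by
    refine hlo.trans_lt ?_
    rw [neg_div]; linarith
  obtain ⟨a', ha1, ha2⟩ := exists_between hlt
  have := eventually_lt_of_limsup_lt ha1 h3
  have h5 : -a' ≤ liminf V atTop := le_liminf_of_le h1.isCoboundedUnder_ge
    (this.mono fun t ht ↦ by linarith)
  linarith

end Feller


/-! ### Integrals of bounded functions -/

theorem integrable_of_abs_le {α : Type*} [MeasurableSpace α] {μ : Measure α} [IsFiniteMeasure μ]
    {f : α → ℝ} (hf : Measurable f) {b : ℝ} (hb : ∀ x, |f x| ≤ b) : Integrable f μ :=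
  Integrable.of_bound hf.aestronglyMeasurable b (.of_forall hb)

theorem intervalIntegrable_of_abs_le {f : ℝ → ℝ} (hf : Measurable f) {b : ℝ}
    (hb : ∀ x, |f x| ≤ b) (x y : ℝ) : IntervalIntegrable f volume x y :=
  ⟨integrable_of_abs_le hf hb, integrable_of_abs_le hf hb⟩

theorem abs_integral_le_of_abs_le {α : Type*} [MeasurableSpace α] {μ : Measure α}
    [IsProbabilityMeasure μ] {f : α → ℝ} {b : ℝ} (hb : ∀ x, |f x| ≤ b) :
    |∫ x, f x ∂μ| ≤ b := by
  have := norm_integral_le_of_norm_le_const (μ := μ) (f := f) (C := b) (.of_forall hb)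
  simpa using this

theorem intervalIntegral_integral_swap_of_abs_le {α : Type*} [MeasurableSpace α] {μ : Measure α}
    [IsFiniteMeasure μ] {f : ℝ → α → ℝ} (hf : Measurable (Function.uncurry f)) {b : ℝ}
    (hb : ∀ x y, |f x y| ≤ b) (u v : ℝ) :
    ∫ x in u..v, ∫ y, f x y ∂μ = ∫ y, (∫ x in u..v, f x y) ∂μ := by
  have : IsFiniteMeasure (volume.restrict (Set.uIoc u v)) := by
    rw [Set.uIoc]; infer_instance
  exact intervalIntegral_integral_swap (integrable_of_abs_le hf fun p ↦ hb p.1 p.2)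

/-! ### The stationary age distribution -/

section StationaryAge

variable {S : Type*} [MeasurableSpace S] {Q : Measure S} {τ : S → ℝ}

/-- The unnormalized stationary age distribution `∫ volume.restrict [0, τ s) dQ(s)` of a renewal
process: its density at `y ≥ 0` is `Q {s | y < τ s}` and its mass is the mean of `τ`. -/
noncomputable def ageMeasure (Q : Measure S) (τ : S → ℝ) : Measure ℝ :=
  ((Q.prod volume).restrict {p : S × ℝ | 0 ≤ p.2 ∧ p.2 < τ p.1}).map Prod.snd

theorem measurableSet_underGraph (hτ : Measurable τ) :
    MeasurableSet {p : S × ℝ | 0 ≤ p.2 ∧ p.2 < τ p.1} :=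
  (measurableSet_le measurable_const measurable_snd).inter
    (measurableSet_lt measurable_snd (hτ.comp measurable_fst))

theorem prod_underGraph (hτ : Measurable τ) :
    (Q.prod volume) {p : S × ℝ | 0 ≤ p.2 ∧ p.2 < τ p.1} = ∫⁻ s, ENNReal.ofReal (τ s) ∂Q := by
  rw [Measure.prod_apply (measurableSet_underGraph hτ)]
  congr 1 with s
  have : Prod.mk s ⁻¹' {p : S × ℝ | 0 ≤ p.2 ∧ p.2 < τ p.1} = Set.Ico 0 (τ s) := rfl
  rw [this, Real.volume_Ico, sub_zero]

theorem ageMeasure_univ (hτ : Measurable τ) :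
    ageMeasure Q τ Set.univ = ∫⁻ s, ENNReal.ofReal (τ s) ∂Q := by
  rw [ageMeasure, Measure.map_apply measurable_snd .univ, Set.preimage_univ,
    Measure.restrict_apply_univ, prod_underGraph hτ]

theorem prod_underGraph_lt_top (hτ : Measurable τ) (hτi : Integrable τ Q) :
    (Q.prod volume) {p : S × ℝ | 0 ≤ p.2 ∧ p.2 < τ p.1} < ⊤ := by
  rw [prod_underGraph hτ]
  exact hτi.lintegral_lt_top

theorem isFiniteMeasure_ageMeasure (hτ : Measurable τ) (hτi : Integrable τ Q) :
    IsFiniteMeasure (ageMeasure Q τ) :=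
  ⟨by rw [ageMeasure_univ hτ]; exact hτi.lintegral_lt_top⟩

theorem ageMeasure_real_univ (hτ : Measurable τ) (hτ0 : ∀ᵐ s ∂Q, 0 ≤ τ s) :
    (ageMeasure Q τ).real Set.univ = ∫ s, τ s ∂Q := by
  rw [measureReal_def, ageMeasure_univ hτ,
    integral_eq_lintegral_of_nonneg_ae hτ0 hτ.aestronglyMeasurable]

theorem ae_ageMeasure_nonneg (hτ : Measurable τ) : ∀ᵐ y ∂(ageMeasure Q τ), 0 ≤ y := by
  rw [ageMeasure, ae_map_iff measurable_snd.aemeasurable measurableSet_Ici]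
  filter_upwards [ae_restrict_mem (measurableSet_underGraph hτ)] with p hp using hp.1

theorem integral_ageMeasure (hτ : Measurable τ) {f : ℝ → ℝ} (hf : Measurable f) :
    ∫ y, f y ∂(ageMeasure Q τ) =
      ∫ p, Set.indicator {p : S × ℝ | 0 ≤ p.2 ∧ p.2 < τ p.1} (fun p ↦ f p.2) p
        ∂(Q.prod volume) := by
  rw [ageMeasure, integral_map measurable_snd.aemeasurable hf.aestronglyMeasurable,
    integral_indicator (measurableSet_underGraph hτ)]

theorem integrable_indicator_underGraph (hτ : Measurable τ) (hτi : Integrable τ Q)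
    {f : S × ℝ → ℝ} (hf : AEStronglyMeasurable f
      ((Q.prod volume).restrict {p : S × ℝ | 0 ≤ p.2 ∧ p.2 < τ p.1}))
    {b : ℝ} (hb : ∀ y, |f y| ≤ b) :
    Integrable (Set.indicator {p : S × ℝ | 0 ≤ p.2 ∧ p.2 < τ p.1} f) (Q.prod volume) := by
  rw [integrable_indicator_iff (measurableSet_underGraph hτ)]
  have : IsFiniteMeasure ((Q.prod volume).restrict {p : S × ℝ | 0 ≤ p.2 ∧ p.2 < τ p.1}) :=
    ⟨by rw [Measure.restrict_apply_univ]; exact prod_underGraph_lt_top hτ hτi⟩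
  exact Integrable.of_bound hf b (.of_forall hb)

variable [IsProbabilityMeasure Q]

theorem ageMeasure_le_volume : ageMeasure Q τ ≤ volume := by
  refine Measure.le_iff.2 fun A hA ↦ ?_
  rw [ageMeasure, Measure.map_apply measurable_snd hA]
  refine (Measure.restrict_apply_le _ _).trans ?_
  rw [← Set.univ_prod, Measure.prod_prod, measure_univ, one_mul]

theorem integral_ageMeasure_eq_integral_interval (hτ : Measurable τ) (hτ0 : ∀ᵐ s ∂Q, 0 ≤ τ s)
    (hτi : Integrable τ Q) {f : ℝ → ℝ} (hf : Measurable f) {b : ℝ} (hb : ∀ y, |f y| ≤ b) :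
    ∫ y, f y ∂(ageMeasure Q τ) = ∫ s, (∫ y in 0..τ s, f y) ∂Q := by
  rw [integral_ageMeasure hτ hf, integral_prod _
    (integrable_indicator_underGraph hτ hτi (f := fun p ↦ f p.2)
      (hf.comp measurable_snd).aestronglyMeasurable fun p ↦ hb p.2)]
  refine integral_congr_ae ?_
  filter_upwards [hτ0] with s hs
  rw [intervalIntegral.integral_of_le hs, ← integral_Ico_eq_integral_Ioc,
    ← integral_indicator measurableSet_Ico]
  rfl

theorem integral_ageMeasure_eq_integral_tail (hτ : Measurable τ)
    (hτi : Integrable τ Q) {f : ℝ → ℝ} (hf : Measurable f) {b : ℝ} (hb : ∀ y, |f y| ≤ b) :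
    ∫ y, f y ∂(ageMeasure Q τ) = ∫ y in Set.Ici 0, f y * Q.real {s | y < τ s} := by
  rw [integral_ageMeasure hτ hf, integral_prod_symm _
    (integrable_indicator_underGraph hτ hτi (f := fun p ↦ f p.2)
      (hf.comp measurable_snd).aestronglyMeasurable fun p ↦ hb p.2),
    ← integral_indicator measurableSet_Ici]
  congr 1 with y
  by_cases hy : 0 ≤ y
  · rw [Set.indicator_of_mem (Set.mem_Ici.2 hy)]
    have : ∀ s, Set.indicator {p : S × ℝ | 0 ≤ p.2 ∧ p.2 < τ p.1} (fun p ↦ f p.2) (s, y) =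
        Set.indicator {s | y < τ s} (fun _ ↦ f y) s := by
      intro s
      by_cases h : y < τ s <;> simp [h, hy]
    simp_rw [this]
    rw [integral_indicator_const _ (measurableSet_lt measurable_const hτ), smul_eq_mul, mul_comm]
  · rw [Set.indicator_of_notMem (by simpa using hy)]
    simp [hy]

end StationaryAge

/-! ### The renewal equation -/

section Smoothing

variable {S : Type*} [MeasurableSpace S] {Q : Measure S} [IsProbabilityMeasure Q] {τ : S → ℝ}

/-- The conserved quantity of the renewal equation: integrating `Z = z + E Z(· - τ)` over `[0, t]`
gives the average of `Z (t - ·)` against the stationary age distribution. -/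
theorem integral_ageMeasure_sub (hτ : Measurable τ) (hτ0 : ∀ᵐ s ∂Q, 0 ≤ τ s)
    (hτi : Integrable τ Q) {Z : ℝ → ℝ} (hZ : Measurable Z) {b : ℝ} (hb : ∀ t, |Z t| ≤ b)
    (hZ0 : ∀ t < 0, Z t = 0) (t : ℝ) :
    ∫ y, Z (t - y) ∂(ageMeasure Q τ) = ∫ u in 0..t, (Z u - ∫ s, Z (u - τ s) ∂Q) := by
  have hm : Measurable (Function.uncurry fun (u : ℝ) (s : S) ↦ Z (u - τ s)) :=
    hZ.comp (measurable_fst.sub (hτ.comp measurable_snd))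
  have hm' : Measurable fun u ↦ ∫ s, Z (u - τ s) ∂Q :=
    (hm.stronglyMeasurable.integral_prod_right (ν := Q)).measurable
  have hi := intervalIntegrable_of_abs_le hZ hb
  rw [integral_ageMeasure_eq_integral_interval hτ hτ0 hτi (f := fun y ↦ Z (t - y))
    (hZ.comp (measurable_const.sub measurable_id)) (fun y ↦ hb _),
    intervalIntegral.integral_sub (hi _ _)
    (intervalIntegrable_of_abs_le hm' (fun u ↦ abs_integral_le_of_abs_le fun s ↦ hb _) _ _),
    intervalIntegral_integral_swap_of_abs_le hm (fun _ _ ↦ hb _)]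
  have e0 : ∫ u in 0..t, Z u = ∫ _, (∫ u in 0..t, Z u) ∂Q := by simp
  have hint : Integrable (fun s ↦ ∫ u in 0..t, Z (u - τ s)) Q := by
    refine integrable_of_abs_le ?_ (b := b * |t - 0|) fun s ↦ ?_
    · have : Measurable fun s ↦ ∫ u in 0..t, (fun (s : S) (u : ℝ) ↦ Z (u - τ s)) s u := by
        simp only [intervalIntegral]
        have h2 : Measurable (Function.uncurry fun (s : S) (u : ℝ) ↦ Z (u - τ s)) :=
          hm.comp measurable_swap
        exact (h2.stronglyMeasurable.integral_prod_right).measurable.sub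
          (h2.stronglyMeasurable.integral_prod_right).measurable
      exact this
    · exact intervalIntegral.norm_integral_le_of_norm_le_const (f := fun u ↦ Z (u - τ s))
        fun u _ ↦ hb _
  rw [e0, ← integral_sub (integrable_const _) hint]
  refine integral_congr_ae ?_
  filter_upwards [hτ0] with s hs
  rw [intervalIntegral.integral_comp_sub_left, intervalIntegral.integral_comp_sub_right Z (τ s),
    sub_zero, zero_sub, ← intervalIntegral.integral_interval_sub_left (hi 0 t) (hi 0 (t - τ s)),
    ← intervalIntegral.integral_add_adjacent_intervals (hi (-τ s) 0) (hi 0 (t - τ s))]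
  have : ∫ u in -τ s..0, Z u = 0 := by
    refine intervalIntegral.integral_zero_ae ?_
    filter_upwards [Measure.ae_ne volume 0] with u hu hu'
    rw [Set.uIoc_of_le (by linarith)] at hu'
    exact hZ0 u (lt_of_le_of_ne hu'.2 hu)
  rw [this, zero_add]

/-- The averages of a convergent function over windows of length `h` converge to the same limit. -/
theorem tendsto_average {f : ℝ → ℝ} (hf : Measurable f) {L : ℝ} (hL : Tendsto f atTop (𝓝 L))
    {h : ℝ} (hh : 0 < h) :
    Tendsto (fun t ↦ h⁻¹ * ∫ r in 0..h, f (t + r)) atTop (𝓝 L) := by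
  have h1 : Tendsto (fun t ↦ ∫ r in 0..h, f (t + r)) atTop (𝓝 (∫ _ in 0..h, L)) := by
    refine intervalIntegral.tendsto_integral_filter_of_dominated_convergence (fun _ ↦ |L| + 1)
      ?_ ?_ (by simp) ?_
    · exact .of_forall fun t ↦ (hf.comp (measurable_const.add measurable_id)).aestronglyMeasurable
    · have h2 : ∀ᶠ x in atTop, dist (f x) L < 1 := hL.eventually (Metric.ball_mem_nhds L one_pos)
      obtain ⟨a, ha⟩ := eventually_atTop.1 h2
      filter_upwards [eventually_ge_atTop a] with t ht
      refine .of_forall fun r hr ↦ ?_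
      rw [Set.uIoc_of_le hh.le] at hr
      have := ha (t + r) (by linarith [hr.1])
      rw [Real.dist_eq] at this
      have h3 := abs_sub_abs_le_abs_sub (f (t + r)) L
      rw [Real.norm_eq_abs]; linarith
    · exact .of_forall fun r _ ↦ hL.comp (tendsto_atTop_add_const_right _ r tendsto_id)
  have h2 := h1.const_mul h⁻¹
  rwa [intervalIntegral.integral_const, sub_zero, smul_eq_mul, inv_mul_cancel_left₀ hh.ne'] at h2

/-- **Renewal theorem for averages** of a solution of the renewal equation `Z = z + E Z(· - τ)`. -/
theorem tendsto_average_of_renewal (hτ : Measurable τ) (hτ0 : ∀ᵐ s ∂Q, 0 ≤ τ s)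
    (hna : ∀ d : ℝ, 0 < d → ¬ ∀ᵐ s ∂Q, ∃ k : ℤ, τ s = k * d)
    (hτi : Integrable τ Q) (hτp : 0 < ∫ s, τ s ∂Q)
    {Z : ℝ → ℝ} (hZ : Measurable Z) {b : ℝ} (hb : ∀ t, |Z t| ≤ b)
    (hZ0 : ∀ t < 0, Z t = 0) {z : ℝ → ℝ} (hz : ∀ t, Z t = z t + ∫ s, Z (t - τ s) ∂Q)
    (hzi : IntegrableOn z (Set.Ioi 0)) {h : ℝ} (hh : 0 < h) :
    Tendsto (fun t ↦ h⁻¹ * ∫ r in 0..h, Z (t + r)) atTop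
      (𝓝 ((∫ t in Set.Ioi 0, z t) / ∫ s, τ s ∂Q)) := by
  have hm : Measurable (Function.uncurry fun (u : ℝ) (s : S) ↦ Z (u - τ s)) :=
    hZ.comp (measurable_fst.sub (hτ.comp measurable_snd))
  have hm' : Measurable fun u ↦ ∫ s, Z (u - τ s) ∂Q :=
    (hm.stronglyMeasurable.integral_prod_right (ν := Q)).measurable
  have hz' : ∀ t, z t = Z t - ∫ s, Z (t - τ s) ∂Q := fun t ↦ by rw [hz t]; ring
  have hzm : Measurable z := by
    rw [funext hz']; exact hZ.sub hm'
  have hzb : ∀ t, |z t| ≤ b + b := fun t ↦ by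
    rw [hz']
    exact (abs_sub _ _).trans (add_le_add (hb t) (abs_integral_le_of_abs_le fun s ↦ hb _))
  have hi := intervalIntegrable_of_abs_le hZ hb
  have hzii := intervalIntegrable_of_abs_le hzm hzb
  set V : ℝ → ℝ := fun t ↦ h⁻¹ * ∫ r in 0..h, Z (t + r) with hVdef
  have hVb : ∀ t, |V t| ≤ b := fun t ↦ by
    rw [hVdef, abs_mul, abs_of_pos (inv_pos.2 hh), inv_mul_le_iff₀ hh]
    refine (intervalIntegral.norm_integral_le_of_norm_le_const (f := fun r ↦ Z (t + r)) (C := b)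
      fun u _ ↦ hb _).trans ?_
    rw [sub_zero, abs_of_pos hh, mul_comm]
  have hb0 : 0 ≤ b := (abs_nonneg _).trans (hb 0)
  have hVlip : LipschitzWith (Real.toNNReal (h⁻¹ * (2 * b))) V := by
    refine LipschitzWith.of_dist_le_mul fun t t' ↦ ?_
    rw [Real.coe_toNNReal _ (by positivity), Real.dist_eq, Real.dist_eq, hVdef, ← mul_sub,
      abs_mul, abs_of_pos (inv_pos.2 hh), mul_assoc]
    refine mul_le_mul_of_nonneg_left ?_ (inv_pos.2 hh).le
    rw [intervalIntegral.integral_comp_add_left, intervalIntegral.integral_comp_add_left,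
      intervalIntegral.integral_interval_sub_interval_comm' (hi _ _) (hi _ _) (hi _ _)]
    refine (abs_sub _ _).trans ?_
    have e1 := intervalIntegral.norm_integral_le_of_norm_le_const (f := Z) (a := t' + h)
      (b := t + h) (C := b) fun u _ ↦ hb _
    have e2 := intervalIntegral.norm_integral_le_of_norm_le_const (f := Z) (a := t' + 0)
      (b := t + 0) (C := b) fun u _ ↦ hb _
    rw [show t + h - (t' + h) = t - t' by ring, Real.norm_eq_abs] at e1
    rw [show t + 0 - (t' + 0) = t - t' by ring, Real.norm_eq_abs] at e2
    linarith
  -- the primitive of `z`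
  set I : ℝ → ℝ := fun t ↦ ∫ u in 0..t, z u with hI
  have hIm : Measurable I := (intervalIntegral.continuous_primitive hzii 0).measurable
  have hIlim : Tendsto I atTop (𝓝 (∫ t in Set.Ioi 0, z t)) :=
    intervalIntegral_tendsto_integral_Ioi 0 hzi tendsto_id
  have hv : ∀ t, V t - ∫ s, V (t - τ s) ∂Q = h⁻¹ * (I (t + h) - I t) := by
    intro t
    have hm2 : Measurable (Function.uncurry fun (r : ℝ) (s : S) ↦ Z (t - τ s + r)) :=
      hZ.comp ((measurable_const.sub (hτ.comp measurable_snd)).add measurable_fst)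
    rw [hVdef]
    simp only
    rw [integral_const_mul, ← intervalIntegral_integral_swap_of_abs_le hm2 (fun _ _ ↦ hb _),
      ← mul_sub, hI]
    simp only
    have e2 : ∀ r s, t - τ s + r = t + r - τ s := fun r s ↦ by ring
    simp_rw [e2]
    rw [← intervalIntegral.integral_sub (f := fun r ↦ Z (t + r))
      (g := fun r ↦ ∫ s, Z (t + r - τ s) ∂Q)
      (intervalIntegrable_of_abs_le (hZ.comp (measurable_const.add measurable_id))
        (fun _ ↦ hb _) _ _)
      (intervalIntegrable_of_abs_le (hm'.comp (measurable_const.add measurable_id))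
        (fun u ↦ abs_integral_le_of_abs_le fun s ↦ hb _) _ _),
      intervalIntegral.integral_interval_sub_left (hzii _ _) (hzii _ _)]
    congr 1
    simp_rw [← hz']
    rw [intervalIntegral.integral_comp_add_left, add_zero]
  have hv0 : Tendsto (fun t ↦ V t - ∫ s, V (t - τ s) ∂Q) atTop (𝓝 0) := by
    simp_rw [hv]
    have := ((hIlim.comp (tendsto_atTop_add_const_right _ h tendsto_id)).sub hIlim).const_mul h⁻¹
    simpa using this
  have hfin := isFiniteMeasure_ageMeasure (Q := Q) hτ hτi
  -- the conserved quantity for `V` is an average of the one for `Z`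
  have hcons : Tendsto (fun t ↦ ∫ y, V (t - y) ∂(ageMeasure Q τ)) atTop
      (𝓝 (∫ t in Set.Ioi 0, z t)) := by
    refine (tendsto_average hIm hIlim hh).congr fun t ↦ ?_
    have hm2 : Measurable (Function.uncurry fun (r y : ℝ) ↦ Z (t - y + r)) :=
      hZ.comp ((measurable_const.sub measurable_snd).add measurable_fst)
    rw [hVdef]
    simp only
    rw [integral_const_mul, ← intervalIntegral_integral_swap_of_abs_le hm2 (fun _ _ ↦ hb _)]
    congr 1
    refine intervalIntegral.integral_congr fun r _ ↦ ?_
    have e2 : ∀ y, t - y + r = t + r - y := fun y ↦ by ring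
    simp_rw [e2]
    rw [integral_ageMeasure_sub hτ hτ0 hτi hZ hb hZ0, hI]
    simp_rw [← hz']
  have := tendsto_of_conserved hτ hτ0 hna hVlip hVb hv0 (ae_ageMeasure_nonneg hτ)
    (by rw [ageMeasure_real_univ hτ hτ0]; exact hτp) hcons
  rwa [ageMeasure_real_univ hτ hτ0] at this

end Smoothing

/-- **Comparison principle** for the renewal equation: a bounded subsolution of
`B t = E B (t - τ)` which is nonpositive at negative times is nonpositive.
The weight `exp (-t)` turns convolution with
the law of `τ` into a contraction. -/
theorem nonpos_of_le_integral_sub {S : Type*} [MeasurableSpace S] {Q : Measure S}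
    [IsProbabilityMeasure Q] {τ : S → ℝ} (hτ : Measurable τ) (hτ0 : ∀ᵐ s ∂Q, 0 ≤ τ s)
    (hτp : 0 < ∫ s, τ s ∂Q) {B : ℝ → ℝ} (hB : Measurable B) {b : ℝ} (hb : ∀ t, |B t| ≤ b)
    (hB0 : ∀ t < 0, B t ≤ 0) (h : ∀ t ≥ 0, B t ≤ ∫ s, B (t - τ s) ∂Q) (t : ℝ) : B t ≤ 0 := by
  have hexp : Integrable (fun s ↦ Real.exp (-τ s)) Q := by
    refine Integrable.of_bound (hτ.neg.exp).aestronglyMeasurable 1 ?_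
    filter_upwards [hτ0] with s hs
    rw [Real.norm_eq_abs, Real.abs_exp, Real.exp_le_one_iff]; linarith
  set c := ∫ s, Real.exp (-τ s) ∂Q with hc
  have hc1 : c < 1 := by
    by_contra! hc1
    have hnn : 0 ≤ᵐ[Q] fun s ↦ 1 - Real.exp (-τ s) := by
      filter_upwards [hτ0] with s hs
      have : Real.exp (-τ s) ≤ 1 := by rw [Real.exp_le_one_iff]; linarith
      simpa using this
    have hle : ∫ s, (1 - Real.exp (-τ s)) ∂Q ≤ 0 := by
      rw [integral_sub (integrable_const _) hexp]
      simpa using hc1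
    have h0 := (integral_eq_zero_iff_of_nonneg_ae hnn ((integrable_const _).sub hexp)).1
      (le_antisymm hle (integral_nonneg_of_ae hnn))
    have : ∫ s, τ s ∂Q = 0 := by
      rw [integral_congr_ae (g := fun _ ↦ 0), integral_zero]
      filter_upwards [h0] with s hs
      have : Real.exp (-τ s) = 1 := by simp only [Pi.zero_apply] at hs; linarith
      rw [Real.exp_eq_one_iff] at this
      linarith
    linarith
  have hb0 : 0 ≤ b := (abs_nonneg _).trans (hb 0)
  -- the supremum `M` of the weighted positive part of `B` satisfies `M ≤ c * M` with `c < 1`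
  set G : ℝ → ℝ := fun t ↦ Real.exp (-t) * max (B t) 0 with hG
  have hGneg : ∀ t < 0, G t = 0 := fun t ht ↦ by simp [hG, hB0 t ht]
  have hGb : BddAbove (Set.range G) := by
    refine ⟨b, ?_⟩
    rintro _ ⟨t, rfl⟩
    rcases lt_or_ge t 0 with ht | ht
    · rw [hGneg t ht]; exact hb0
    · have h1 : Real.exp (-t) ≤ 1 := by rw [Real.exp_le_one_iff]; linarith
      have h2 : max (B t) 0 ≤ b := max_le ((le_abs_self _).trans (hb t)) hb0
      calc G t ≤ 1 * b := mul_le_mul h1 h2 (le_max_right _ _) zero_le_one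
        _ = b := one_mul b
  set M := ⨆ t, G t with hM
  have hGM : ∀ t, G t ≤ M := fun t ↦ le_ciSup hGb t
  have hM0 : 0 ≤ M := by rw [← hGneg (-1) (by norm_num)]; exact hGM _
  have hBG : ∀ t, max (B t) 0 = Real.exp t * G t := fun t ↦ by
    rw [hG]; simp only; rw [← mul_assoc, ← Real.exp_add]; simp
  have hBM : ∀ t, B t ≤ Real.exp t * M := fun t ↦
    (le_max_left _ _).trans ((hBG t).le.trans
      (mul_le_mul_of_nonneg_left (hGM t) (Real.exp_pos t).le))
  have hG' : ∀ t, G t ≤ c * M := by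
    intro t
    have hc0 : 0 ≤ c := integral_nonneg fun s ↦ (Real.exp_pos _).le
    rcases lt_or_ge t 0 with ht | ht
    · rw [hGneg t ht]; positivity
    · have h1 : B t ≤ Real.exp t * (c * M) := by
        refine (h t ht).trans ?_
        have h2 : ∫ s, B (t - τ s) ∂Q ≤ ∫ s, Real.exp t * M * Real.exp (-τ s) ∂Q := by
          refine integral_mono (integrable_of_abs_le (hB.comp (measurable_const.sub hτ))
            fun s ↦ hb _) (hexp.const_mul _) fun s ↦ (hBM _).trans_eq ?_
          rw [sub_eq_add_neg, Real.exp_add]; ring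
        rw [integral_const_mul, ← hc] at h2
        linarith
      have h3 : max (B t) 0 ≤ Real.exp t * (c * M) := max_le h1 (by positivity)
      rw [hBG] at h3
      exact le_of_mul_le_mul_left h3 (Real.exp_pos t)
  have hMc : M ≤ c * M := ciSup_le hG'
  have hM00 : M = 0 := by nlinarith
  have := hBM t
  rwa [hM00, mul_zero] at this


/-! ### Sequences of cycles -/

section Sequences

variable {S : Type*} {τ : S → ℝ}

/-- The start of cycle `n` in the sequence of cycles `w`, a cycle `s` having length `τ s`. -/
def epoch (τ : S → ℝ) (w : ℕ → S) (n : ℕ) : ℝ := ∑ k ∈ Finset.range n, τ (w k)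

/-- The index of the cycle in progress at time `t`: the last one that has started. If infinitely
many have, as for a sequence that is not `IsProper`, it is `0` by the convention for `sSup`. -/
noncomputable def cycleIndex (τ : S → ℝ) (t : ℝ) (w : ℕ → S) : ℕ := sSup {n | epoch τ w n ≤ t}

/-- The time elapsed at `t` since the start of the cycle in progress. -/
noncomputable def age (τ : S → ℝ) (t : ℝ) (w : ℕ → S) : ℝ := t - epoch τ w (cycleIndex τ t w)

/-- The value at time `t` of the regenerative process with kernel `c`, which is worth `c s r` at
time `r` after the start of a cycle `s`. -/
noncomputable def cycleValue (τ : S → ℝ) (c : S → ℝ → ℝ) (t : ℝ) (w : ℕ → S) : ℝ :=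
  c (w (cycleIndex τ t w)) (age τ t w)

/-- The cycle `s` followed by the cycles `w`. -/
def consCycle (s : S) (w : ℕ → S) : ℕ → S
  | 0 => s
  | n + 1 => w n

@[simp] theorem consCycle_zero (s : S) (w : ℕ → S) : consCycle s w 0 = s := rfl

@[simp] theorem consCycle_succ (s : S) (w : ℕ → S) (n : ℕ) : consCycle s w (n + 1) = w n := rfl

/-- Sequences of cycles with nonnegative lengths that cover the whole half-line. -/
structure IsProper (τ : S → ℝ) (w : ℕ → S) : Prop where
  nonneg : ∀ k, 0 ≤ τ (w k)
  tendsto : Tendsto (epoch τ w) atTop atTop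

@[simp] theorem epoch_zero (w : ℕ → S) : epoch τ w 0 = 0 := by simp [epoch]

theorem epoch_consCycle_succ (s : S) (w : ℕ → S) (n : ℕ) :
    epoch τ (consCycle s w) (n + 1) = τ s + epoch τ w n := by
  simp [epoch, Finset.sum_range_succ', add_comm]

theorem IsProper.monotone_epoch {w : ℕ → S} (hw : IsProper τ w) : Monotone (epoch τ w) :=
  monotone_nat_of_le_succ fun n ↦ by
    rw [epoch, epoch, Finset.sum_range_succ]; linarith [hw.nonneg n]

theorem IsProper.bddAbove {w : ℕ → S} (hw : IsProper τ w) (t : ℝ) :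
    BddAbove {n | epoch τ w n ≤ t} := by
  obtain ⟨N, hN⟩ := eventually_atTop.1 (hw.tendsto.eventually (eventually_gt_atTop t))
  refine ⟨N, fun n hn ↦ ?_⟩
  by_contra! h
  exact absurd hn (not_le.2 (hN n h.le))

theorem IsProper.epoch_le {w : ℕ → S} (hw : IsProper τ w) {t : ℝ} (ht : 0 ≤ t) :
    epoch τ w (cycleIndex τ t w) ≤ t :=
  Nat.sSup_mem (s := {n | epoch τ w n ≤ t}) ⟨0, by simpa using ht⟩ (hw.bddAbove t)

theorem IsProper.lt_epoch {w : ℕ → S} (hw : IsProper τ w) (t : ℝ) :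
    t < epoch τ w (cycleIndex τ t w + 1) := by
  by_contra! h
  have := le_csSup (hw.bddAbove t) h
  exact absurd this (by rw [not_le]; exact Nat.lt_succ_self _)

theorem IsProper.cycleIndex_eq {w : ℕ → S} (hw : IsProper τ w) {t : ℝ} {n : ℕ}
    (h1 : epoch τ w n ≤ t) (h2 : t < epoch τ w (n + 1)) : cycleIndex τ t w = n := by
  refine le_antisymm ?_ (le_csSup (hw.bddAbove t) h1)
  refine csSup_le ⟨n, h1⟩ fun k hk ↦ ?_
  by_contra! hlt
  exact absurd (h2.trans_le (hw.monotone_epoch hlt)) (not_lt.2 hk)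

theorem IsProper.cons {w : ℕ → S} (hw : IsProper τ w) {s : S} (hs : 0 ≤ τ s) :
    IsProper τ (consCycle s w) where
  nonneg := fun k ↦ by cases k <;> simp [hs, hw.nonneg]
  tendsto := by
    rw [← tendsto_add_atTop_iff_nat 1]
    simp_rw [epoch_consCycle_succ]
    exact tendsto_atTop_add_const_left _ _ hw.tendsto

theorem IsProper.cycleIndex_consCycle {w : ℕ → S} (hw : IsProper τ w) {s : S} (hs : 0 ≤ τ s)
    {t : ℝ} (ht : τ s ≤ t) :
    cycleIndex τ t (consCycle s w) = cycleIndex τ (t - τ s) w + 1 := by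
  refine (hw.cons hs).cycleIndex_eq ?_ ?_
  · rw [epoch_consCycle_succ]
    linarith [hw.epoch_le (sub_nonneg.2 ht)]
  · rw [epoch_consCycle_succ]
    linarith [hw.lt_epoch (t - τ s)]

theorem IsProper.age_consCycle {w : ℕ → S} (hw : IsProper τ w) {s : S} (hs : 0 ≤ τ s)
    {t : ℝ} (ht : τ s ≤ t) : age τ t (consCycle s w) = age τ (t - τ s) w := by
  rw [age, hw.cycleIndex_consCycle hs ht, epoch_consCycle_succ, age]; ring

theorem IsProper.cycleValue_consCycle {w : ℕ → S} (hw : IsProper τ w) {s : S} (hs : 0 ≤ τ s)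
    {t : ℝ} (ht : τ s ≤ t) (c : S → ℝ → ℝ) :
    cycleValue τ c t (consCycle s w) = cycleValue τ c (t - τ s) w := by
  rw [cycleValue, hw.cycleIndex_consCycle hs ht, hw.age_consCycle hs ht, consCycle_succ, cycleValue]

theorem IsProper.cycleIndex_of_lt {w : ℕ → S} (hw : IsProper τ w) {t : ℝ} (ht0 : 0 ≤ t)
    (ht : t < τ (w 0)) : cycleIndex τ t w = 0 :=
  hw.cycleIndex_eq (by simpa using ht0) (by simpa [epoch] using ht)

theorem IsProper.cycleValue_of_lt {w : ℕ → S} (hw : IsProper τ w) {t : ℝ} (ht0 : 0 ≤ t)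
    (ht : t < τ (w 0)) (c : S → ℝ → ℝ) : cycleValue τ c t w = c (w 0) t := by
  rw [cycleValue, age, hw.cycleIndex_of_lt ht0 ht]; simp

theorem IsProper.age_of_lt {w : ℕ → S} (hw : IsProper τ w) {t : ℝ} (ht0 : 0 ≤ t)
    (ht : t < τ (w 0)) : age τ t w = t := by
  rw [age, hw.cycleIndex_of_lt ht0 ht]; simp

/-- The age grows at most at unit speed. -/
theorem IsProper.age_add_le {w : ℕ → S} (hw : IsProper τ w) {t r : ℝ} (ht0 : 0 ≤ t)
    (hr : 0 ≤ r) : age τ (t + r) w ≤ age τ t w + r := by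
  have h1 : cycleIndex τ t w ≤ cycleIndex τ (t + r) w :=
    le_csSup (hw.bddAbove _) ((hw.epoch_le ht0).trans (by linarith))
  have := hw.monotone_epoch h1
  rw [age, age]; linarith

end Sequences

/-! ### Measurability in the sequence of cycles -/

section Measurability

variable {S : Type*} [MeasurableSpace S] {τ : S → ℝ}

theorem measurable_epoch (hτ : Measurable τ) (n : ℕ) :
    Measurable fun w : ℕ → S ↦ epoch τ w n :=
  Finset.measurable_fun_sum _ fun k _ ↦ hτ.comp (measurable_pi_apply k)

theorem measurable_cycleIndex (hτ : Measurable τ) :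
    Measurable fun p : ℝ × (ℕ → S) ↦ cycleIndex τ p.1 p.2 := by
  have hle : ∀ n, MeasurableSet {p : ℝ × (ℕ → S) | epoch τ p.2 n ≤ p.1} := fun n ↦
    measurableSet_le ((measurable_epoch hτ n).comp measurable_snd) measurable_fst
  -- a positive supremum is attained and bounds the set, while the value `0` also occurs as the
  -- supremum of an unbounded or empty set: deal with it by complementation
  have hpos : ∀ n, MeasurableSet ((fun p : ℝ × (ℕ → S) ↦ cycleIndex τ p.1 p.2) ⁻¹' {n + 1}) := by
    intro n
    have : (fun p : ℝ × (ℕ → S) ↦ cycleIndex τ p.1 p.2) ⁻¹' {n + 1} =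
        {p | epoch τ p.2 (n + 1) ≤ p.1} ∩
          ⋂ k, {p | epoch τ p.2 (n + 1 + (k + 1)) ≤ p.1}ᶜ := by
      ext p
      simp only [Set.mem_preimage, Set.mem_singleton_iff, Set.mem_inter_iff, Set.mem_ofPred_eq,
        Set.mem_iInter, Set.mem_compl_iff, cycleIndex]
      constructor
      · intro h
        have hb : BddAbove {n | epoch τ p.2 n ≤ p.1} := by
          by_contra hb
          have := Nat.sSup_of_not_bddAbove hb
          omega
        have hne : {n | epoch τ p.2 n ≤ p.1}.Nonempty := by
          by_contra hne
          rw [Set.not_nonempty_iff_eq_empty] at hne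
          rw [hne] at h
          simp at h
        refine ⟨h ▸ Nat.sSup_mem hne hb, fun k hk ↦ ?_⟩
        have := le_csSup hb hk
        omega
      · rintro ⟨h1, h2⟩
        have hub : ∀ k ∈ {n | epoch τ p.2 n ≤ p.1}, k ≤ n + 1 := by
          intro k hk
          by_contra! hlt
          obtain ⟨j, rfl⟩ := Nat.exists_eq_add_of_lt hlt
          exact h2 j (by simpa [add_assoc] using hk)
        exact le_antisymm (csSup_le ⟨_, h1⟩ hub) (le_csSup ⟨_, hub⟩ h1)
    rw [this]
    exact (hle _).inter (.iInter fun k ↦ (hle _).compl)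
  refine measurable_to_countable' fun n ↦ ?_
  cases n with
  | succ n => exact hpos n
  | zero =>
    have : (fun p : ℝ × (ℕ → S) ↦ cycleIndex τ p.1 p.2) ⁻¹' {0} =
        (⋃ n, (fun p : ℝ × (ℕ → S) ↦ cycleIndex τ p.1 p.2) ⁻¹' {n + 1})ᶜ := by
      ext p
      simp only [Set.mem_preimage, Set.mem_singleton_iff, Set.mem_compl_iff, Set.mem_iUnion,
        not_exists]
      constructor
      · intro h n; omega
      · intro h
        by_contra h0
        exact h _ (Nat.succ_pred_eq_of_ne_zero h0).symm
    rw [this]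
    exact (MeasurableSet.iUnion hpos).compl

theorem measurable_age (hτ : Measurable τ) :
    Measurable fun p : ℝ × (ℕ → S) ↦ age τ p.1 p.2 := by
  have h : Measurable fun q : ℕ × (ℝ × (ℕ → S)) ↦ q.2.1 - epoch τ q.2.2 q.1 :=
    measurable_from_prod_countable_right fun n ↦
      measurable_fst.sub ((measurable_epoch hτ n).comp measurable_snd)
  exact h.comp ((measurable_cycleIndex hτ).prodMk measurable_id)

theorem measurable_cycleValue (hτ : Measurable τ) {c : S → ℝ → ℝ}
    (hc : Measurable (Function.uncurry c)) :
    Measurable (Function.uncurry (cycleValue τ c)) := by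
  have h : Measurable fun q : ℕ × (ℝ × (ℕ → S)) ↦ c (q.2.2 q.1) (age τ q.2.1 q.2.2) :=
    measurable_from_prod_countable_right fun n ↦
      hc.comp (((measurable_pi_apply n).comp measurable_snd).prodMk (measurable_age hτ))
  exact h.comp ((measurable_cycleIndex hτ).prodMk measurable_id)

theorem measurable_consCycle :
    Measurable fun p : S × (ℕ → S) ↦ consCycle p.1 p.2 :=
  measurable_pi_iff.2 fun n ↦ by
    cases n with
    | zero => exact measurable_fst
    | succ n => exact (measurable_pi_apply n).comp measurable_snd

variable {Q : Measure S} [IsProbabilityMeasure Q]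

/-- An i.i.d. sequence preceded by an independent term of the same law is again i.i.d. -/
theorem map_consCycle :
    (Q.prod (Measure.infinitePi fun _ : ℕ ↦ Q)).map (fun p ↦ consCycle p.1 p.2) =
      Measure.infinitePi fun _ : ℕ ↦ Q := by
  classical
  refine Measure.eq_infinitePi _ fun s t ht ↦ ?_
  obtain ⟨N, hN⟩ : ∃ N, s ⊆ Finset.range (N + 1) := by
    obtain ⟨N, hN⟩ := s.exists_nat_subset_range
    exact ⟨N, hN.trans (Finset.range_mono (Nat.le_succ N))⟩
  -- enlarge the finite index set to an initial segment
  set t' : ℕ → Set S := fun i ↦ if i ∈ s then t i else Set.univ with ht'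
  have ht'm : ∀ i, MeasurableSet (t' i) := fun i ↦ by
    rw [ht']; dsimp only; split_ifs
    exacts [ht i, .univ]
  have e1 : Set.pi (s : Set ℕ) t = Set.pi (Finset.range (N + 1) : Set ℕ) t' := by
    ext w
    simp only [Set.mem_pi, Finset.mem_coe, ht']
    constructor
    · intro h i _
      split_ifs with hi
      exacts [h i hi, trivial]
    · intro h i hi
      simpa [hi] using h i (hN hi)
  have e2 : ∏ i ∈ s, Q (t i) = ∏ i ∈ Finset.range (N + 1), Q (t' i) := by
    rw [← Finset.prod_subset hN (fun i _ hi ↦ by simp [ht', hi])]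
    exact Finset.prod_congr rfl fun i hi ↦ by simp [ht', hi]
  rw [e1, e2, Measure.map_apply measurable_consCycle
    (.pi (Finset.countable_toSet _) fun i _ ↦ ht'm i)]
  have e3 : (fun p : S × (ℕ → S) ↦ consCycle p.1 p.2) ⁻¹' Set.pi (Finset.range (N + 1) : Set ℕ) t' =
      t' 0 ×ˢ Set.pi (Finset.range N : Set ℕ) fun i ↦ t' (i + 1) := by
    ext ⟨x, w⟩
    simp only [Set.mem_preimage, Set.mem_pi, Finset.mem_coe, Finset.mem_range, Set.mem_prod]
    constructor
    · intro h
      exact ⟨h 0 (Nat.succ_pos _), fun i hi ↦ h (i + 1) (Nat.succ_lt_succ hi)⟩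
    · rintro ⟨h0, h⟩ i hi
      cases i with
      | zero => exact h0
      | succ i => exact h i (Nat.lt_of_succ_lt_succ hi)
  rw [e3, Measure.prod_prod, Measure.infinitePi_pi _ fun i _ ↦ ht'm _, Finset.prod_range_succ',
    mul_comm]

theorem integral_consCycle {Φ : (ℕ → S) → ℝ} (hΦ : Measurable Φ) {b : ℝ} (hb : ∀ w, |Φ w| ≤ b) :
    ∫ w, Φ w ∂(Measure.infinitePi fun _ : ℕ ↦ Q) =
      ∫ s, ∫ w, Φ (consCycle s w) ∂(Measure.infinitePi fun _ : ℕ ↦ Q) ∂Q := by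
  conv_lhs => rw [← map_consCycle]
  rw [integral_map measurable_consCycle.aemeasurable hΦ.aestronglyMeasurable]
  exact integral_prod _ (integrable_of_abs_le (hΦ.comp measurable_consCycle) fun p ↦ hb _)

/-- By the law of large numbers, almost every sequence of cycles covers the half-line. -/
theorem ae_isProper (hτ : Measurable τ) (hτ0 : ∀ᵐ s ∂Q, 0 ≤ τ s) (hτi : Integrable τ Q)
    (hτp : 0 < ∫ s, τ s ∂Q) : ∀ᵐ w ∂(Measure.infinitePi fun _ : ℕ ↦ Q), IsProper τ w := by
  have hmp : ∀ k, MeasurePreserving (fun w : ℕ → S ↦ w k) (Measure.infinitePi fun _ : ℕ ↦ Q) Q :=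
    fun k ↦ measurePreserving_eval_infinitePi (fun _ : ℕ ↦ Q) k
  have h1 : ∀ᵐ w ∂(Measure.infinitePi fun _ : ℕ ↦ Q), ∀ k, 0 ≤ τ (w k) :=
    ae_all_iff.2 fun k ↦ (hmp k).quasiMeasurePreserving.ae hτ0
  have hint : ∫ w, τ (w 0) ∂(Measure.infinitePi fun _ : ℕ ↦ Q) = ∫ s, τ s ∂Q := by
    rw [← (hmp 0).map_eq,
      integral_map (hmp 0).measurable.aemeasurable hτ.aestronglyMeasurable, (hmp 0).map_eq]
  have hind : iIndepFun (fun k (w : ℕ → S) ↦ τ (w k)) (Measure.infinitePi fun _ : ℕ ↦ Q) :=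
    iIndepFun_infinitePi (P := fun _ : ℕ ↦ Q) (X := fun _ ↦ τ) fun _ ↦ hτ
  have h2 := strong_law_ae_real (fun k (w : ℕ → S) ↦ τ (w k))
    ((hmp 0).integrable_comp_of_integrable hτi) (fun i j hij ↦ hind.indepFun hij) fun k ↦
      { aemeasurable_fst := (hτ.comp (measurable_pi_apply k)).aemeasurable
        aemeasurable_snd := (hτ.comp (measurable_pi_apply 0)).aemeasurable
        map_eq := by
          change Measure.map (τ ∘ fun w : ℕ → S ↦ w k) _ = Measure.map (τ ∘ fun w : ℕ → S ↦ w 0) _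
          rw [← Measure.map_map hτ (hmp k).measurable, ← Measure.map_map hτ (hmp 0).measurable,
            (hmp k).map_eq, (hmp 0).map_eq] }
  filter_upwards [h1, h2] with w hw1 hw2
  refine ⟨hw1, ?_⟩
  rw [hint] at hw2
  have := hw2.pos_mul_atTop hτp tendsto_natCast_atTop_atTop
  refine this.congr' ?_
  filter_upwards [eventually_ne_atTop 0] with n hn
  rw [div_mul_cancel₀ _ (Nat.cast_ne_zero.2 hn)]; rfl

end Measurability

/-! ### Conditioning on the first cycle -/

section OneStep

variable {S : Type*} [MeasurableSpace S] {Q : Measure S} [IsProbabilityMeasure Q] {τ : S → ℝ}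

/-- The mean of a functional `G t` of an i.i.d. sequence of cycles, set to `0` for `t < 0`. -/
noncomputable def cycleMean (Q : Measure S) [IsProbabilityMeasure Q] (G : ℝ → (ℕ → S) → ℝ) (t : ℝ) :
    ℝ :=
  if 0 ≤ t then ∫ w, G t w ∂(Measure.infinitePi fun _ : ℕ ↦ Q) else 0

theorem cycleMean_of_nonneg {G : ℝ → (ℕ → S) → ℝ} {t : ℝ} (ht : 0 ≤ t) :
    cycleMean Q G t = ∫ w, G t w ∂(Measure.infinitePi fun _ : ℕ ↦ Q) := if_pos ht

theorem cycleMean_of_neg {G : ℝ → (ℕ → S) → ℝ} {t : ℝ} (ht : t < 0) :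
    cycleMean Q G t = 0 := if_neg (not_le.2 ht)

theorem abs_cycleMean_le {G : ℝ → (ℕ → S) → ℝ} {b : ℝ} (hb : ∀ t w, |G t w| ≤ b) (t : ℝ) :
    |cycleMean Q G t| ≤ b := by
  rcases lt_or_ge t 0 with ht | ht
  · have hS : Nonempty (ℕ → S) :=
      nonempty_of_isProbabilityMeasure (Measure.infinitePi fun _ : ℕ ↦ Q)
    rw [cycleMean_of_neg ht, abs_zero]
    exact (abs_nonneg _).trans (hb t hS.some)
  · rw [cycleMean_of_nonneg ht]
    exact abs_integral_le_of_abs_le (hb t)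

theorem measurable_cycleMean {G : ℝ → (ℕ → S) → ℝ} (hG : Measurable (Function.uncurry G)) :
    Measurable (cycleMean Q G) :=
  Measurable.ite measurableSet_Ici
    (hG.stronglyMeasurable.integral_prod_right (ν := Measure.infinitePi fun _ : ℕ ↦ Q)).measurable
    measurable_const

/-- **Renewal equation**, obtained by conditioning on the first cycle: if it is over at time `t`,
the functional only sees the shifted sequence of cycles, by `hshift`. -/
theorem cycleMean_eq (hτ : Measurable τ) (hτ0 : ∀ᵐ s ∂Q, 0 ≤ τ s) (hτi : Integrable τ Q)
    (hτp : 0 < ∫ s, τ s ∂Q) {G : ℝ → (ℕ → S) → ℝ} (hG : Measurable (Function.uncurry G))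
    {b : ℝ} (hb : ∀ t w, |G t w| ≤ b)
    (hshift : ∀ s w t, 0 ≤ τ s → IsProper τ w → τ s ≤ t →
      G t (consCycle s w) = G (t - τ s) w) {t : ℝ} (ht : 0 ≤ t) :
    cycleMean Q G t =
      ∫ s, Set.indicator {s | t < τ s}
        (fun s ↦ ∫ w, G t (consCycle s w) ∂(Measure.infinitePi fun _ : ℕ ↦ Q)) s ∂Q
      + ∫ s, cycleMean Q G (t - τ s) ∂Q := by
  have hGt : Measurable (G t) := hG.comp (measurable_const.prodMk measurable_id)
  have hm : Measurable fun s ↦ ∫ w, G t (consCycle s w) ∂(Measure.infinitePi fun _ : ℕ ↦ Q) :=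
    ((hGt.comp measurable_consCycle).stronglyMeasurable.integral_prod_right
      (f := fun s w ↦ G t (consCycle s w))
      (ν := Measure.infinitePi fun _ : ℕ ↦ Q)).measurable
  have hmb : ∀ s, |∫ w, G t (consCycle s w) ∂(Measure.infinitePi fun _ : ℕ ↦ Q)| ≤ b := fun s ↦
    abs_integral_le_of_abs_le fun w ↦ hb _ _
  have hset : MeasurableSet {s | t < τ s} := measurableSet_lt measurable_const hτ
  rw [cycleMean_of_nonneg ht, integral_consCycle hGt (hb t), ← integral_add
    ((integrable_of_abs_le hm hmb).indicator hset)
    (integrable_of_abs_le (f := fun s ↦ cycleMean Q G (t - τ s))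
      ((measurable_cycleMean hG).comp (measurable_const.sub hτ)) fun s ↦ abs_cycleMean_le hb _)]
  refine integral_congr_ae ?_
  filter_upwards [hτ0] with s hs
  by_cases h : t < τ s
  · rw [Set.indicator_of_mem (s := {s | t < τ s}) h,
      cycleMean_of_neg (by linarith), add_zero]
  · rw [Set.indicator_of_notMem (s := {s | t < τ s}) h, zero_add,
      cycleMean_of_nonneg (by linarith)]
    refine integral_congr_ae ?_
    filter_upwards [ae_isProper hτ hτ0 hτi hτp] with w hw
    exact hshift s w t hs hw (not_lt.1 h)

/-- The contribution of the first cycle to the mean of the regenerative process with kernel `c`. -/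
noncomputable def firstCycleMean {S : Type*} [MeasurableSpace S] (Q : Measure S) (τ : S → ℝ)
    (c : S → ℝ → ℝ) (t : ℝ) : ℝ :=
  ∫ s, Set.indicator {s | t < τ s} (fun s ↦ c s t) s ∂Q

/-- The renewal equation for the mean of a regenerative process. -/
theorem cycleMean_cycleValue_eq (hτ : Measurable τ) (hτ0 : ∀ᵐ s ∂Q, 0 ≤ τ s)
    (hτi : Integrable τ Q) (hτp : 0 < ∫ s, τ s ∂Q) {c : S → ℝ → ℝ}
    (hc : Measurable (Function.uncurry c)) {b : ℝ} (hb : ∀ s t, |c s t| ≤ b) {t : ℝ} (ht : 0 ≤ t) :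
    cycleMean Q (cycleValue τ c) t =
      firstCycleMean Q τ c t + ∫ s, cycleMean Q (cycleValue τ c) (t - τ s) ∂Q := by
  rw [cycleMean_eq (G := cycleValue τ c) hτ hτ0 hτi hτp (measurable_cycleValue hτ hc)
    (fun _ _ ↦ hb _ _) (fun s w t hs hw hst ↦ hw.cycleValue_consCycle hs hst c) ht, firstCycleMean]
  congr 1
  refine integral_congr_ae ?_
  filter_upwards [hτ0] with s hs
  by_cases h : t < τ s
  · rw [Set.indicator_of_mem (s := {s | t < τ s}) h, Set.indicator_of_mem (s := {s | t < τ s}) h]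
    rw [integral_congr_ae (g := fun _ ↦ c s t)]
    · simp
    · filter_upwards [ae_isProper hτ hτ0 hτi hτp] with w hw
      exact (hw.cons hs).cycleValue_of_lt ht h c
  · rw [Set.indicator_of_notMem (s := {s | t < τ s}) h,
      Set.indicator_of_notMem (s := {s | t < τ s}) h]

end OneStep


/-! ### Convergence of the age -/

section AgeLimit

variable {S : Type*} [MeasurableSpace S] {Q : Measure S} {τ : S → ℝ}

theorem firstCycleMean_const (hτ : Measurable τ) (g : ℝ → ℝ) (t : ℝ) :
    firstCycleMean Q τ (fun _ ↦ g) t = g t * Q.real {s | t < τ s} := by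
  rw [firstCycleMean, integral_indicator_const _ (measurableSet_lt measurable_const hτ),
    smul_eq_mul, mul_comm]

variable [IsProbabilityMeasure Q]

theorem integrableOn_firstCycleMean (hτ : Measurable τ) (hτi : Integrable τ Q) {c : S → ℝ → ℝ}
    (hc : Measurable (Function.uncurry c)) {b : ℝ} (hb : ∀ s t, |c s t| ≤ b) :
    IntegrableOn (firstCycleMean Q τ c) (Set.Ioi 0) := by
  have h := (integrable_indicator_underGraph hτ hτi hc.aestronglyMeasurable
    fun p ↦ hb p.1 p.2).integral_prod_right
  refine (h.integrableOn (s := Set.Ioi 0)).congr_fun (fun t ht ↦ ?_) measurableSet_Ioi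
  refine integral_congr_ae (.of_forall fun s ↦ ?_)
  have ht' : 0 ≤ t := le_of_lt ht
  by_cases h : t < τ s <;> simp [h, ht']

theorem tendsto_average_cycleMean (hτ : Measurable τ) (hτ0 : ∀ᵐ s ∂Q, 0 ≤ τ s)
    (hna : ∀ d : ℝ, 0 < d → ¬ ∀ᵐ s ∂Q, ∃ k : ℤ, τ s = k * d)
    (hτi : Integrable τ Q) (hτp : 0 < ∫ s, τ s ∂Q) {c : S → ℝ → ℝ}
    (hc : Measurable (Function.uncurry c)) {b : ℝ} (hb : ∀ s t, |c s t| ≤ b)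
    {h : ℝ} (hh : 0 < h) :
    Tendsto (fun t ↦ h⁻¹ * ∫ r in 0..h, cycleMean Q (cycleValue τ c) (t + r)) atTop
      (𝓝 ((∫ t in Set.Ioi 0, firstCycleMean Q τ c t) / ∫ s, τ s ∂Q)) := by
  set z : ℝ → ℝ := Set.indicator (Set.Ici 0) (firstCycleMean Q τ c) with hz
  have hzi : ∫ t in Set.Ioi 0, firstCycleMean Q τ c t = ∫ t in Set.Ioi 0, z t :=
    setIntegral_congr_fun measurableSet_Ioi fun t ht ↦
      (Set.indicator_of_mem (Set.mem_Ici.2 (le_of_lt ht)) _).symm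
  rw [hzi]
  refine tendsto_average_of_renewal (Z := cycleMean Q (cycleValue τ c)) hτ hτ0 hna hτi hτp
    (measurable_cycleMean (measurable_cycleValue hτ hc)) (abs_cycleMean_le fun _ _ ↦ hb _ _)
    (fun t ht ↦ cycleMean_of_neg ht) (fun t ↦ ?_) ?_ hh
  · rcases lt_or_ge t 0 with ht | ht
    · rw [cycleMean_of_neg ht, hz, Set.indicator_of_notMem (by simpa using ht), zero_add,
        integral_congr_ae (g := fun _ ↦ 0), integral_zero]
      filter_upwards [hτ0] with s hs
      exact cycleMean_of_neg (by linarith)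
    · rw [cycleMean_cycleValue_eq hτ hτ0 hτi hτp hc hb ht, hz,
        Set.indicator_of_mem (Set.mem_Ici.2 ht)]
  · exact (integrableOn_firstCycleMean hτ hτi hc hb).congr_fun (fun t ht ↦
      (Set.indicator_of_mem (Set.mem_Ici.2 (le_of_lt ht)) _).symm) measurableSet_Ioi

/-- The process `1_{age < x}` as a regenerative process. -/
theorem cycleMean_indicator (hτ : Measurable τ) (x : ℝ) {t : ℝ} (ht : 0 ≤ t) :
    cycleMean Q (cycleValue τ fun _ ↦ Set.indicator (Set.Iio x) 1) t =
      (Measure.infinitePi fun _ : ℕ ↦ Q).real {w | age τ t w < x} := by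
  have hm : MeasurableSet {w : ℕ → S | age τ t w < x} :=
    measurableSet_lt ((measurable_age hτ).comp (measurable_const.prodMk measurable_id))
      measurable_const
  rw [cycleMean_of_nonneg ht, ← integral_indicator_one hm]
  rfl

theorem ageMeasure_real_Iio_sub_le (hτ : Measurable τ) (hτi : Integrable τ Q) {x y : ℝ}
    (hxy : x ≤ y) :
    (ageMeasure Q τ).real (Set.Iio y) ≤ (ageMeasure Q τ).real (Set.Iio x) + (y - x) := by
  have := isFiniteMeasure_ageMeasure (Q := Q) hτ hτi
  rw [← Set.Iio_union_Ico_eq_Iio hxy]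
  refine (measureReal_union_le _ _).trans ?_
  gcongr
  have h := ageMeasure_le_volume (Q := Q) (τ := τ) (Set.Ico x y)
  rw [Real.volume_Ico] at h
  exact ENNReal.toReal_le_of_le_ofReal (by linarith) h

/-- The distribution function of the age converges. The averages converge by the renewal theorem,
and the age grows at most at unit speed, which sandwiches the distribution function at `x` between
averages of those at `x - h` and `x + h`. -/
theorem tendsto_measureReal_age_lt (hτ : Measurable τ) (hτ0 : ∀ᵐ s ∂Q, 0 ≤ τ s)
    (hna : ∀ d : ℝ, 0 < d → ¬ ∀ᵐ s ∂Q, ∃ k : ℤ, τ s = k * d)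
    (hτi : Integrable τ Q) (hτp : 0 < ∫ s, τ s ∂Q) (x : ℝ) :
    Tendsto (fun t ↦ (Measure.infinitePi fun _ : ℕ ↦ Q).real {w | age τ t w < x}) atTop
      (𝓝 ((ageMeasure Q τ).real (Set.Iio x) / ∫ s, τ s ∂Q)) := by
  set μ := ∫ s, τ s ∂Q
  set F : ℝ → ℝ := fun x ↦ (ageMeasure Q τ).real (Set.Iio x) with hF
  set p : ℝ → ℝ → ℝ := fun x t ↦ cycleMean Q (cycleValue τ fun _ ↦ Set.indicator (Set.Iio x) 1) t
    with hp
  have hind : ∀ x : ℝ, Measurable (Set.indicator (Set.Iio x) (1 : ℝ → ℝ)) := fun x ↦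
    measurable_one.indicator measurableSet_Iio
  have hcm : ∀ x : ℝ, Measurable (Function.uncurry fun (_ : S) ↦ Set.indicator (Set.Iio x)
      (1 : ℝ → ℝ)) := fun x ↦ (hind x).comp measurable_snd
  have hcb : ∀ x y : ℝ, |Set.indicator (Set.Iio x) (1 : ℝ → ℝ) y| ≤ 1 := fun x y ↦ by
    by_cases h : y < x <;> simp [h]
  have hpm : ∀ x, Measurable (p x) := fun x ↦
    measurable_cycleMean (measurable_cycleValue hτ (hcm x))
  have hpb : ∀ x t, |p x t| ≤ 1 := fun x ↦ abs_cycleMean_le fun _ _ ↦ hcb x _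
  have havg : ∀ x h : ℝ, 0 < h →
      Tendsto (fun t ↦ h⁻¹ * ∫ r in 0..h, p x (t + r)) atTop (𝓝 (F x / μ)) := by
    intro x h hh
    have := tendsto_average_cycleMean hτ hτ0 hna hτi hτp (hcm x) (fun _ ↦ hcb x) hh
    convert this using 3
    rw [hF]
    simp only
    rw [← integral_indicator_one measurableSet_Iio,
      integral_ageMeasure_eq_integral_tail hτ hτi (hind x) (hcb x), integral_Ici_eq_integral_Ioi]
    simp_rw [firstCycleMean_const hτ]
  -- unit speed of the age
  have hmono : ∀ x t r : ℝ, 0 ≤ t → 0 ≤ r → p x t ≤ p (x + r) (t + r) := by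
    intro x t r ht hr
    rw [hp]; simp only
    rw [cycleMean_indicator hτ x ht, cycleMean_indicator hτ (x + r) (by linarith)]
    refine ENNReal.toReal_mono (measure_ne_top _ _) (measure_mono_ae ?_)
    filter_upwards [ae_isProper hτ hτ0 hτi hτp] with w hw (hwx : age τ t w < x)
    exact (hw.age_add_le ht hr).trans_lt (by linarith)
  have hmono' : ∀ x y t : ℝ, 0 ≤ t → x ≤ y → p x t ≤ p y t := by
    intro x y t ht hxy
    rw [hp]; simp only
    rw [cycleMean_indicator hτ x ht, cycleMean_indicator hτ y ht]
    exact measureReal_mono fun w (hw : _ < _) ↦ hw.trans_le hxy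
  have hii : ∀ x t h : ℝ, IntervalIntegrable (fun r ↦ p x (t + r)) volume 0 h := fun x t h ↦
    intervalIntegrable_of_abs_le ((hpm x).comp (measurable_const.add measurable_id))
      (fun r ↦ hpb x _) _ _
  have hupper : ∀ h > 0, ∀ t ≥ 0, p x t ≤ h⁻¹ * ∫ r in 0..h, p (x + h) (t + r) := by
    intro h hh t ht
    have h1 : ∫ _ in 0..h, p x t ≤ ∫ r in 0..h, p (x + h) (t + r) := by
      refine intervalIntegral.integral_mono_on hh.le intervalIntegrable_const (hii _ _ _)
        fun r hr ↦ ?_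
      exact (hmono x t r ht hr.1).trans (hmono' _ _ _ (by linarith [hr.1]) (by linarith [hr.2]))
    rw [intervalIntegral.integral_const, sub_zero, smul_eq_mul] at h1
    rwa [← div_eq_inv_mul, le_div_iff₀ hh, mul_comm]
  have hlower : ∀ h > 0, ∀ t ≥ h, h⁻¹ * ∫ r in 0..h, p (x - h) (t - h + r) ≤ p x t := by
    intro h hh t ht
    have h1 : ∫ r in 0..h, p (x - h) (t - h + r) ≤ ∫ _ in 0..h, p x t := by
      refine intervalIntegral.integral_mono_on hh.le (hii _ _ _) intervalIntegrable_const
        fun r hr ↦ ?_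
      have h2 := hmono (x - h) (t - h + r) (h - r) (by linarith [hr.1]) (by linarith [hr.2])
      rw [show t - h + r + (h - r) = t by ring] at h2
      exact h2.trans (hmono' _ _ _ (by linarith) (by linarith [hr.1]))
    rw [intervalIntegral.integral_const, sub_zero, smul_eq_mul] at h1
    rwa [← div_eq_inv_mul, div_le_iff₀ hh, mul_comm]
  -- `F` is Lipschitz, so that a small `h` brings both bounds close to `F x / μ`
  have hFle : ∀ x y, x ≤ y → F y ≤ F x + (y - x) := fun x y hxy ↦
    ageMeasure_real_Iio_sub_le hτ hτi hxy
  have hmain : Tendsto (p x) atTop (𝓝 (F x / μ)) := by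
    rw [tendsto_order]
    constructor
    · intro a ha
      set h := (F x / μ - a) * μ / 2 with hh
      have hd : 0 < (F x / μ - a) * μ := mul_pos (by linarith) hτp
      have hh0 : 0 < h := by rw [hh]; positivity
      have h1 : a < F (x - h) / μ := by
        have := hFle (x - h) x (by linarith)
        rw [lt_div_iff₀ hτp]
        rw [sub_mul, div_mul_cancel₀ _ hτp.ne'] at hd hh
        linarith
      have h2 := ((havg (x - h) h hh0).comp
        (tendsto_atTop_add_const_right atTop (-h) tendsto_id)).eventually (lt_mem_nhds h1)
      filter_upwards [h2, eventually_ge_atTop h] with t ht1 ht2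
      exact lt_of_lt_of_le (by simpa [sub_eq_add_neg] using ht1) (hlower h hh0 t ht2)
    · intro a ha
      set h := (a - F x / μ) * μ / 2 with hh
      have hd : 0 < (a - F x / μ) * μ := mul_pos (by linarith) hτp
      have hh0 : 0 < h := by rw [hh]; positivity
      have h1 : F (x + h) / μ < a := by
        have := hFle x (x + h) (by linarith)
        rw [div_lt_iff₀ hτp]
        rw [sub_mul, div_mul_cancel₀ _ hτp.ne'] at hd hh
        linarith
      have h2 := (havg (x + h) h hh0).eventually (gt_mem_nhds h1)
      filter_upwards [h2, eventually_ge_atTop 0] with t ht1 ht2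
      exact (hupper h hh0 t ht2).trans_lt ht1
  refine hmain.congr' ?_
  filter_upwards [eventually_ge_atTop 0] with t ht
  exact cycleMean_indicator hτ x ht

end AgeLimit


/-! ### Weak convergence and right-continuous functions -/

section RightContinuous

/-- A point of `g ⁻¹' U` outside the interior is isolated on its right in the complement of the
interior, and there are only countably many such points. -/
theorem countable_preimage_diff_interior {g : ℝ → ℝ}
    (hg : ∀ x, ContinuousWithinAt g (Set.Ici x) x) {U : Set ℝ} (hU : IsOpen U) :
    (g ⁻¹' U \ interior (g ⁻¹' U)).Countable := by
  refine (countable_setOfPred_isolated_right_within (s := (interior (g ⁻¹' U))ᶜ)).mono ?_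
  rintro x ⟨hx, hxi⟩
  refine ⟨hxi, ?_⟩
  have h1 : g ⁻¹' U ∈ 𝓝[≥] x := (hg x).preimage_mem_nhdsWithin (hU.mem_nhds hx)
  obtain ⟨y, hy, hxy⟩ := mem_nhdsGE_iff_exists_Ico_subset.1 h1
  have h2 : Set.Ioo x y ⊆ interior (g ⁻¹' U) :=
    interior_maximal (Set.Ioo_subset_Ico_self.trans hxy) isOpen_Ioo
  rw [← empty_mem_iff_bot, mem_nhdsWithin]
  refine ⟨Set.Iio y, isOpen_Iio, hy, ?_⟩
  rintro z ⟨hzy, hzi, hzx⟩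
  exact hzi (h2 ⟨hzx, hzy⟩)

/-- Weak convergence to a measure without atoms passes to bounded right-continuous functions: such
a function has only countably many discontinuities. -/
theorem tendsto_integral_of_rightContinuous {ι : Type*} {L : Filter ι} [L.IsCountablyGenerated]
    {μs : ι → ProbabilityMeasure ℝ} {μ : ProbabilityMeasure ℝ} (hμ : Tendsto μs L (𝓝 μ))
    (hμ0 : ∀ x, (μ : Measure ℝ) {x} = 0) {g : ℝ → ℝ} (hgm : Measurable g)
    (hg : ∀ x, ContinuousWithinAt g (Set.Ici x) x) {b : ℝ} (hb : ∀ x, |g x| ≤ b) :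
    Tendsto (fun i ↦ ∫ x, g x ∂(μs i : Measure ℝ)) L (𝓝 (∫ x, g x ∂(μ : Measure ℝ))) := by
  have : NullSingletonClass (μ : Measure ℝ) := ⟨hμ0⟩
  have hmap : Tendsto (fun i ↦ (μs i).map hgm.aemeasurable) L (𝓝 (μ.map hgm.aemeasurable)) := by
    refine tendsto_of_forall_isOpen_le_liminf' fun U hU ↦ ?_
    simp only [ProbabilityMeasure.toMeasure_map]
    simp_rw [Measure.map_apply hgm hU.measurableSet]
    have h1 : (μ : Measure ℝ) (g ⁻¹' U) = (μ : Measure ℝ) (interior (g ⁻¹' U)) := by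
      refine le_antisymm ?_ (measure_mono interior_subset)
      have := (countable_preimage_diff_interior hg hU).measure_zero (μ : Measure ℝ)
      calc (μ : Measure ℝ) (g ⁻¹' U)
          ≤ (μ : Measure ℝ) (interior (g ⁻¹' U)) +
              (μ : Measure ℝ) (g ⁻¹' U \ interior (g ⁻¹' U)) := by
            refine (measure_mono ?_).trans (measure_union_le _ _)
            rw [Set.union_sdiff_self]
            exact Set.subset_union_right
        _ = _ := by rw [this, add_zero]
    rw [h1]
    refine (ProbabilityMeasure.le_liminf_measure_open_of_tendsto hμ isOpen_interior).trans ?_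
    exact liminf_le_liminf (.of_forall fun i ↦ measure_mono interior_subset)
  -- integrate the truncation at level `b`, which is a bounded continuous function
  have hb0 : -b ≤ b := by linarith [(abs_nonneg _).trans (hb 0)]
  let φ : ℝ →ᵇ ℝ := BoundedContinuousFunction.ofNormedAddCommGroup
    (fun x ↦ max (-b) (min b x)) (by fun_prop) b fun x ↦ by
      rw [Real.norm_eq_abs, abs_le]
      exact ⟨le_max_left _ _, max_le hb0 (min_le_left _ _)⟩
  have hφ : ∀ x, φ (g x) = g x := fun x ↦ by
    change max (-b) (min b (g x)) = g x
    rw [min_eq_right (abs_le.1 (hb x)).2, max_eq_right (abs_le.1 (hb x)).1]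
  have hint := ProbabilityMeasure.tendsto_iff_forall_integral_tendsto.1 hmap φ
  simp only [ProbabilityMeasure.toMeasure_map] at hint
  simp_rw [integral_map hgm.aemeasurable φ.continuous.measurable.aestronglyMeasurable, hφ] at hint
  exact hint

end RightContinuous

/-! ### Convergence at one time -/

section OneDim

variable {S : Type*} [MeasurableSpace S] {Q : Measure S} {τ : S → ℝ}

theorem isProbabilityMeasure_smul_ageMeasure (hτ : Measurable τ) (hτ0 : ∀ᵐ s ∂Q, 0 ≤ τ s)
    (hτi : Integrable τ Q) (hτp : 0 < ∫ s, τ s ∂Q) :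
    IsProbabilityMeasure (ENNReal.ofReal (∫ s, τ s ∂Q)⁻¹ • ageMeasure Q τ) := by
  constructor
  have := isFiniteMeasure_ageMeasure (Q := Q) hτ hτi
  rw [Measure.smul_apply, ← ofReal_measureReal (measure_ne_top _ _),
    ageMeasure_real_univ hτ hτ0, smul_eq_mul, ← ENNReal.ofReal_mul (inv_nonneg.2 hτp.le),
    inv_mul_cancel₀ hτp.ne', ENNReal.ofReal_one]

/-- The contribution of the first cycle is right continuous if the kernel is. -/
theorem continuousWithinAt_firstCycleMean [IsFiniteMeasure Q] (hτ : Measurable τ) {c : S → ℝ → ℝ}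
    (hc : ∀ t, Measurable fun s ↦ c s t) {b : ℝ} (hb : ∀ s t, |c s t| ≤ b) {t : ℝ}
    (hrc : ∀ᵐ s ∂Q, ContinuousWithinAt (c s) (Set.Ici t) t) :
    ContinuousWithinAt (firstCycleMean Q τ c) (Set.Ici t) t := by
  refine tendsto_integral_filter_of_dominated_convergence (fun _ ↦ b) ?_ ?_
    (integrable_const _) ?_
  · exact .of_forall fun u ↦ ((hc u).indicator
      (measurableSet_lt measurable_const hτ)).aestronglyMeasurable
  · refine .of_forall fun u ↦ .of_forall fun s ↦ ?_
    by_cases h : u < τ s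
    · rw [Set.indicator_of_mem (s := {s | u < τ s}) h]; exact hb s u
    · rw [Set.indicator_of_notMem (s := {s | u < τ s}) h, norm_zero]
      exact (abs_nonneg _).trans (hb s u)
  · filter_upwards [hrc] with s hs
    by_cases h : t < τ s
    · rw [Set.indicator_of_mem (s := {s | t < τ s}) h]
      refine Tendsto.congr' ?_ hs
      filter_upwards [nhdsWithin_le_nhds (gt_mem_nhds h)] with u hu
      rw [Set.indicator_of_mem (s := {s | u < τ s}) hu]
    · rw [Set.indicator_of_notMem (s := {s | t < τ s}) h]
      refine Tendsto.congr' ?_ tendsto_const_nhds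
      filter_upwards [self_mem_nhdsWithin] with u hu
      rw [Set.indicator_of_notMem (s := {s | u < τ s})]
      exact fun h' ↦ h (lt_of_le_of_lt hu h')

theorem measurable_firstCycleMean [SFinite Q] (hτ : Measurable τ) {c : S → ℝ → ℝ}
    (hc : Measurable (Function.uncurry c)) : Measurable (firstCycleMean Q τ c) := by
  have h : Measurable (Function.uncurry fun (t : ℝ) (s : S) ↦
      Set.indicator {s | t < τ s} (fun s ↦ c s t) s) := by
    have h2 : Measurable fun p : ℝ × S ↦ c p.2 p.1 := hc.comp measurable_swap
    exact h2.indicator (measurableSet_lt measurable_fst (hτ.comp measurable_snd))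
  exact (h.stronglyMeasurable.integral_prod_right (ν := Q)).measurable

theorem abs_firstCycleMean_le [IsFiniteMeasure Q] (hτ : Measurable τ) {c : S → ℝ → ℝ}
    {b : ℝ} (hb : ∀ s t, |c s t| ≤ b) (t : ℝ) :
    |firstCycleMean Q τ c t| ≤ b * Q.real {s | t < τ s} := by
  have hm : MeasurableSet {s | t < τ s} := measurableSet_lt measurable_const hτ
  have h := norm_integral_le_of_norm_le (μ := Q)
    (f := Set.indicator {s | t < τ s} (fun s ↦ c s t)) (g := Set.indicator {s | t < τ s} fun _ ↦ b)
    ((integrable_const b).indicator hm) (.of_forall fun s ↦ by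
      rw [norm_indicator_eq_indicator_norm]
      exact Set.indicator_le_indicator (hb s t))
  rwa [integral_indicator_const _ hm, smul_eq_mul, mul_comm] at h

variable [IsProbabilityMeasure Q]

theorem measurable_age_apply (hτ : Measurable τ) (t : ℝ) : Measurable (age τ t) :=
  (measurable_age hτ).comp (measurable_const.prodMk measurable_id)

/-- The law of the age at time `t`. -/
noncomputable def ageLaw (Q : Measure S) [IsProbabilityMeasure Q] (hτ : Measurable τ) (t : ℝ) :
    ProbabilityMeasure ℝ :=
  ⟨(Measure.infinitePi fun _ : ℕ ↦ Q).map (age τ t),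
    Measure.isProbabilityMeasure_map (measurable_age_apply hτ t).aemeasurable⟩

/-- The age converges in distribution to the stationary age. -/
theorem tendsto_ageLaw (hτ : Measurable τ) (hτ0 : ∀ᵐ s ∂Q, 0 ≤ τ s)
    (hna : ∀ d : ℝ, 0 < d → ¬ ∀ᵐ s ∂Q, ∃ k : ℤ, τ s = k * d)
    (hτi : Integrable τ Q) (hτp : 0 < ∫ s, τ s ∂Q) :
    Tendsto (ageLaw Q hτ) atTop (𝓝 ⟨ENNReal.ofReal (∫ s, τ s ∂Q)⁻¹ • ageMeasure Q τ,
      isProbabilityMeasure_smul_ageMeasure hτ hτ0 hτi hτp⟩) := by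
  set π : ProbabilityMeasure ℝ := ⟨ENNReal.ofReal (∫ s, τ s ∂Q)⁻¹ • ageMeasure Q τ,
      isProbabilityMeasure_smul_ageMeasure hτ hτ0 hτi hτp⟩
  have hIio : ∀ x, Tendsto (fun t ↦ (ageLaw Q hτ t : Measure ℝ).real (Set.Iio x)) atTop
      (𝓝 ((π : Measure ℝ).real (Set.Iio x))) := by
    intro x
    have e : (π : Measure ℝ).real (Set.Iio x) =
        (ageMeasure Q τ).real (Set.Iio x) / ∫ s, τ s ∂Q := by
      change (ENNReal.ofReal (∫ s, τ s ∂Q)⁻¹ • ageMeasure Q τ).real (Set.Iio x) = _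
      rw [measureReal_ennreal_smul_apply, ENNReal.toReal_ofReal (inv_nonneg.2 hτp.le),
        div_eq_inv_mul]
    rw [e]
    refine (tendsto_measureReal_age_lt hτ hτ0 hna hτi hτp x).congr fun t ↦ ?_
    change _ = ((Measure.infinitePi fun _ : ℕ ↦ Q).map (age τ t)).real (Set.Iio x)
    rw [map_measureReal_apply (measurable_age_apply hτ t) measurableSet_Iio]
    rfl
  have hdiff : ∀ (ν : ProbabilityMeasure ℝ) (x y : ℝ), x ≤ y → (ν : Measure ℝ).real (Set.Ico x y) =
      (ν : Measure ℝ).real (Set.Iio y) - (ν : Measure ℝ).real (Set.Iio x) := by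
    intro ν x y hxy
    rw [← Set.Iio_union_Ico_eq_Iio hxy, measureReal_union _ measurableSet_Ico]
    · ring
    · exact Set.disjoint_left.2 fun z hz hz' ↦ absurd hz'.1 (not_le.2 hz)
  refine (isPiSystem_Ico (id : ℝ → ℝ) (id : ℝ → ℝ)).tendsto_probabilityMeasure_of_tendsto_of_mem
    ?_ ?_ ?_
  · rintro _ ⟨x, y, -, rfl⟩
    exact measurableSet_Ico
  · intro u hu x hx
    obtain ⟨ε, hε, h⟩ := Metric.isOpen_iff.1 hu x hx
    refine ⟨_, ⟨x - ε / 2, x + ε / 2, by simp only [id]; linarith, rfl⟩,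
      Ico_mem_nhds (by simp only [id]; linarith) (by simp only [id]; linarith), ?_⟩
    refine subset_trans (fun z hz ↦ ?_) h
    simp only [id, Set.mem_Ico] at hz
    rw [Metric.mem_ball, Real.dist_eq, abs_lt]
    constructor <;> linarith [hz.1, hz.2]
  · rintro _ ⟨x, y, hxy, rfl⟩
    have h1 := (hIio y).sub (hIio x)
    simp_rw [← hdiff _ x y (le_of_lt hxy)] at h1
    rw [← NNReal.tendsto_coe]
    exact h1

/-- **Renewal theorem for regenerative processes**: the mean of a bounded functional of the process
converges as soon as the contribution of the first cycle is right continuous. The mean depends on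
the kernel through this contribution only, so that the kernel can be replaced by a function of the
age, whose convergence in distribution is known. -/
theorem tendsto_cycleMean (hτ : Measurable τ) (hτ0 : ∀ᵐ s ∂Q, 0 ≤ τ s)
    (hna : ∀ d : ℝ, 0 < d → ¬ ∀ᵐ s ∂Q, ∃ k : ℤ, τ s = k * d)
    (hτi : Integrable τ Q) (hτp : 0 < ∫ s, τ s ∂Q) {c : S → ℝ → ℝ}
    (hc : Measurable (Function.uncurry c)) {b : ℝ} (hb : ∀ s t, |c s t| ≤ b)
    (hrc : ∀ t ≥ 0, ContinuousWithinAt (firstCycleMean Q τ c) (Set.Ici t) t) :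
    Tendsto (cycleMean Q (cycleValue τ c)) atTop
      (𝓝 ((∫ t in Set.Ici 0, firstCycleMean Q τ c t) / ∫ s, τ s ∂Q)) := by
  set q : ℝ → ℝ := fun t ↦ Q.real {s | t < τ s}
  set z := firstCycleMean Q τ c
  have hq1 : firstCycleMean Q τ (fun _ _ ↦ 1) = q := by
    ext t; rw [firstCycleMean_const hτ (fun _ ↦ 1), one_mul]
  have hqc : ∀ t, ContinuousWithinAt q (Set.Ici t) t := fun t ↦ by
    rw [← hq1]
    exact continuousWithinAt_firstCycleMean hτ (fun _ ↦ measurable_const) (b := 1) (by simp)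
      (.of_forall fun s ↦ continuousWithinAt_const)
  have hqm : Measurable q := by
    rw [← hq1]; exact measurable_firstCycleMean hτ measurable_const
  have hq0 : ∀ t, 0 ≤ q t := fun t ↦ measureReal_nonneg
  have hqanti : ∀ t u, t ≤ u → q u ≤ q t := fun t u htu ↦
    measureReal_mono fun s (hs : u < τ s) ↦ htu.trans_lt hs
  have hzq : ∀ t, |z t| ≤ b * q t := abs_firstCycleMean_le hτ hb
  have hzm : Measurable z := measurable_firstCycleMean hτ hc
  have hS : Nonempty S := nonempty_of_isProbabilityMeasure Q
  have hb0 : 0 ≤ b := (abs_nonneg _).trans (hb hS.some 0)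
  -- the mean of the process given that the current cycle has age `t`; where `q` vanishes, so does
  -- `z`, and the value `0` of the quotient is harmless
  set g : ℝ → ℝ := fun t ↦ if 0 ≤ t then z t / q t else 0 with hg
  have hgm : Measurable g := Measurable.ite measurableSet_Ici (hzm.div hqm) measurable_const
  have hgb : ∀ t, |g t| ≤ b := by
    intro t
    rw [hg]; simp only
    split_ifs
    · rw [abs_div, abs_of_nonneg (hq0 t)]
      exact div_le_of_le_mul₀ (hq0 t) hb0 (hzq t)
    · simpa using hb0
  have hgz : ∀ t, 0 ≤ t → g t * q t = z t := by
    intro t ht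
    rw [hg]; simp only [ht, if_true]
    by_cases h : q t = 0
    · have := hzq t
      rw [h, mul_zero] at this
      rw [h, mul_zero, abs_nonpos_iff.1 this]
    · exact div_mul_cancel₀ _ h
  have hgc : ∀ t, ContinuousWithinAt g (Set.Ici t) t := by
    intro t
    rcases lt_or_ge t 0 with ht | ht
    · have : g =ᶠ[𝓝 t] fun _ ↦ 0 := by
        filter_upwards [gt_mem_nhds ht] with u hu
        simp [hg, not_le.2 hu]
      exact (continuousAt_const.congr this.symm).continuousWithinAt
    · by_cases h : q t = 0
      · have hzero : ∀ u ∈ Set.Ici t, g u = 0 := fun u hu ↦ by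
          have : q u = 0 := le_antisymm ((hqanti t u hu).trans h.le) (hq0 u)
          simp [hg, this]
        exact continuousWithinAt_const.congr hzero (hzero t Set.self_mem_Ici)
      · have heq : ∀ u ∈ Set.Ici t, g u = z u / q u := fun u hu ↦ by
          simp [hg, le_trans ht hu]
        exact ((hrc t ht).div (hqc t) h).congr heq (heq t Set.self_mem_Ici)
  -- the process and the function `g` of the age satisfy the same renewal equation
  have hgu : Measurable (Function.uncurry fun (_ : S) ↦ g) := hgm.comp measurable_snd
  set Z₁ := cycleMean Q (cycleValue τ c)
  set Z₂ := cycleMean Q (cycleValue τ fun _ ↦ g) with hZ₂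
  have hm₁ : Measurable Z₁ := measurable_cycleMean (measurable_cycleValue hτ hc)
  have hm₂ : Measurable Z₂ := measurable_cycleMean (measurable_cycleValue hτ hgu)
  have hb₁ : ∀ t, |Z₁ t| ≤ b := abs_cycleMean_le fun _ _ ↦ hb _ _
  have hb₂ : ∀ t, |Z₂ t| ≤ b := abs_cycleMean_le fun _ _ ↦ hgb _
  have he₁ : ∀ t ≥ 0, Z₁ t = z t + ∫ s, Z₁ (t - τ s) ∂Q := fun t ht ↦
    cycleMean_cycleValue_eq hτ hτ0 hτi hτp hc hb ht
  have he₂ : ∀ t ≥ 0, Z₂ t = z t + ∫ s, Z₂ (t - τ s) ∂Q := fun t ht ↦ by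
    rw [hZ₂, cycleMean_cycleValue_eq hτ hτ0 hτi hτp hgu (fun _ ↦ hgb) ht,
      firstCycleMean_const hτ, hgz t ht]
  have hle : ∀ W₁ W₂ : ℝ → ℝ, Measurable W₁ → Measurable W₂ → (∀ t, |W₁ t| ≤ b) →
      (∀ t, |W₂ t| ≤ b) → (∀ t < 0, W₁ t = 0) → (∀ t < 0, W₂ t = 0) →
      (∀ t ≥ 0, W₁ t = z t + ∫ s, W₁ (t - τ s) ∂Q) →
      (∀ t ≥ 0, W₂ t = z t + ∫ s, W₂ (t - τ s) ∂Q) → ∀ t, W₁ t - W₂ t ≤ 0 := by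
    intro W₁ W₂ h1 h2 h3 h4 h5 h6 h7 h8
    refine nonpos_of_le_integral_sub (Q := Q) (τ := τ) (B := fun t ↦ W₁ t - W₂ t) hτ hτ0 hτp
      (h1.sub h2) (b := b + b) (fun t ↦ (abs_sub _ _).trans (add_le_add (h3 t) (h4 t)))
      (fun t ht ↦ by simp [h5 t ht, h6 t ht]) fun t ht ↦ ?_
    rw [integral_sub
      (integrable_of_abs_le (f := fun s ↦ W₁ (t - τ s)) (h1.comp (measurable_const.sub hτ))
        fun s ↦ h3 _)
      (integrable_of_abs_le (f := fun s ↦ W₂ (t - τ s)) (h2.comp (measurable_const.sub hτ))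
        fun s ↦ h4 _), h7 t ht, h8 t ht]
    simp
  have hZ : Z₁ = Z₂ := by
    ext t
    have h1 := hle Z₁ Z₂ hm₁ hm₂ hb₁ hb₂ (fun t ht ↦ cycleMean_of_neg ht)
      (fun t ht ↦ cycleMean_of_neg ht) he₁ he₂ t
    have h2 := hle Z₂ Z₁ hm₂ hm₁ hb₂ hb₁ (fun t ht ↦ cycleMean_of_neg ht)
      (fun t ht ↦ cycleMean_of_neg ht) he₂ he₁ t
    linarith
  -- the limit of `Z₂` follows from the weak convergence of the age
  have hlim := tendsto_integral_of_rightContinuous (tendsto_ageLaw hτ hτ0 hna hτi hτp)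
    (fun x ↦ by
      change (ENNReal.ofReal (∫ s, τ s ∂Q)⁻¹ • ageMeasure Q τ) {x} = 0
      have h0 : ageMeasure Q τ {x} = 0 :=
        nonpos_iff_eq_zero.1 ((ageMeasure_le_volume {x}).trans (by simp))
      rw [Measure.smul_apply, h0, smul_zero]) hgm hgc hgb
  have hval : ∫ x, g x ∂(ENNReal.ofReal (∫ s, τ s ∂Q)⁻¹ • ageMeasure Q τ) =
      (∫ t in Set.Ici 0, z t) / ∫ s, τ s ∂Q := by
    rw [integral_smul_measure, ENNReal.toReal_ofReal (inv_nonneg.2 hτp.le), smul_eq_mul,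
      ← div_eq_inv_mul, integral_ageMeasure_eq_integral_tail hτ hτi hgm hgb]
    congr 1
    exact setIntegral_congr_fun measurableSet_Ici fun t ht ↦ hgz t ht
  rw [hZ, ← hval]
  refine hlim.congr' ?_
  filter_upwards [eventually_ge_atTop 0] with t ht
  rw [hZ₂, cycleMean_of_nonneg ht]
  exact integral_map (measurable_age_apply hτ t).aemeasurable hgm.aestronglyMeasurable

end OneDim


/-! ### Asymptotic independence -/

section MultiDim

variable {S : Type*} [MeasurableSpace S] {Q : Measure S} [IsProbabilityMeasure Q] {τ : S → ℝ}

/-- A functional is dominated in mean by another one as soon as it is so, given the first cycle, at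
the times when this cycle is in progress. -/
theorem abs_cycleMean_le_cycleMean (hτ : Measurable τ) (hτ0 : ∀ᵐ s ∂Q, 0 ≤ τ s)
    (hτi : Integrable τ Q) (hτp : 0 < ∫ s, τ s ∂Q) {G H : ℝ → (ℕ → S) → ℝ}
    (hG : Measurable (Function.uncurry G)) (hH : Measurable (Function.uncurry H))
    {a b : ℝ} (ha : ∀ t w, |G t w| ≤ a) (hb : ∀ t w, |H t w| ≤ b)
    (hGs : ∀ s w t, 0 ≤ τ s → IsProper τ w → τ s ≤ t → G t (consCycle s w) = G (t - τ s) w)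
    (hHs : ∀ s w t, 0 ≤ τ s → IsProper τ w → τ s ≤ t → H t (consCycle s w) = H (t - τ s) w)
    (hGH : ∀ s t, 0 ≤ t → t < τ s →
      |∫ w, G t (consCycle s w) ∂(Measure.infinitePi fun _ : ℕ ↦ Q)| ≤
        ∫ w, H t (consCycle s w) ∂(Measure.infinitePi fun _ : ℕ ↦ Q)) (t : ℝ) :
    |cycleMean Q G t| ≤ cycleMean Q H t := by
  have hGm := measurable_cycleMean (Q := Q) hG
  have hHm := measurable_cycleMean (Q := Q) hH
  have hGb := abs_cycleMean_le (Q := Q) ha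
  have hHb := abs_cycleMean_le (Q := Q) hb
  rw [← sub_nonpos]
  refine nonpos_of_le_integral_sub (Q := Q) (τ := τ)
    (B := fun t ↦ |cycleMean Q G t| - cycleMean Q H t) hτ hτ0 hτp (hGm.norm.sub hHm)
    (b := a + b) (fun t ↦ ?_) (fun t ht ↦ ?_) (fun t ht ↦ ?_) t
  · refine (abs_sub _ _).trans (add_le_add ?_ (hHb t))
    rw [abs_abs]; exact hGb t
  · simp [cycleMean_of_neg ht]
  · have i1 : Integrable (fun s ↦ |cycleMean Q G (t - τ s)|) Q :=
      integrable_of_abs_le (hGm.norm.comp (measurable_const.sub hτ)) (b := a) fun s ↦ by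
        rw [abs_abs]; exact hGb _
    have i2 : Integrable (fun s ↦ cycleMean Q H (t - τ s)) Q :=
      integrable_of_abs_le (hHm.comp (measurable_const.sub hτ)) fun s ↦ hHb _
    rw [integral_sub i1 i2, cycleMean_eq hτ hτ0 hτi hτp hG ha hGs ht,
      cycleMean_eq hτ hτ0 hτi hτp hH hb hHs ht]
    have e1 := abs_integral_le_integral_abs (f := fun s ↦ cycleMean Q G (t - τ s)) (μ := Q)
    have hset : MeasurableSet {s | t < τ s} := measurableSet_lt measurable_const hτ
    have hHt : Measurable (H t) := hH.comp (measurable_const.prodMk measurable_id)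
    have hm : Measurable fun s ↦ ∫ w, H t (consCycle s w) ∂(Measure.infinitePi fun _ : ℕ ↦ Q) :=
      ((hHt.comp measurable_consCycle).stronglyMeasurable.integral_prod_right
        (f := fun s w ↦ H t (consCycle s w))
        (ν := Measure.infinitePi fun _ : ℕ ↦ Q)).measurable
    have e2 := norm_integral_le_of_norm_le (μ := Q)
      (f := Set.indicator {s | t < τ s}
        (fun s ↦ ∫ w, G t (consCycle s w) ∂(Measure.infinitePi fun _ : ℕ ↦ Q)))
      (g := Set.indicator {s | t < τ s}
        (fun s ↦ ∫ w, H t (consCycle s w) ∂(Measure.infinitePi fun _ : ℕ ↦ Q)))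
      ((integrable_of_abs_le hm fun s ↦ abs_integral_le_of_abs_le fun w ↦ hb _ _).indicator hset)
      (.of_forall fun s ↦ by
        rw [norm_indicator_eq_indicator_norm]
        by_cases h : t < τ s
        · rw [Set.indicator_of_mem (s := {s | t < τ s}) h,
            Set.indicator_of_mem (s := {s | t < τ s}) h]
          exact hGH s t ht h
        · rw [Set.indicator_of_notMem (s := {s | t < τ s}) h,
            Set.indicator_of_notMem (s := {s | t < τ s}) h])
    rw [Real.norm_eq_abs] at e2
    have e3 := abs_add_le (∫ s, Set.indicator {s | t < τ s}
        (fun s ↦ ∫ w, G t (consCycle s w) ∂(Measure.infinitePi fun _ : ℕ ↦ Q)) s ∂Q)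
      (∫ s, cycleMean Q G (t - τ s) ∂Q)
    linarith

/-- The age is tight. Since `{ℓ ≤ age (t + ℓ)}` is the event that no cycle starts in
`(t, t + ℓ]`, this also bounds the remaining time of the cycle in progress at time `t`. -/
theorem exists_forall_measureReal_le_age (hτ : Measurable τ) (hτ0 : ∀ᵐ s ∂Q, 0 ≤ τ s)
    (hna : ∀ d : ℝ, 0 < d → ¬ ∀ᵐ s ∂Q, ∃ k : ℤ, τ s = k * d)
    (hτi : Integrable τ Q) (hτp : 0 < ∫ s, τ s ∂Q) {ε : ℝ} (hε : 0 < ε) :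
    ∃ K ≥ 0, ∀ ℓ ≥ K, ∀ t ≥ 0,
      (Measure.infinitePi fun _ : ℕ ↦ Q).real {w | ℓ ≤ age τ (t + ℓ) w} ≤ ε := by
  have hfin := isFiniteMeasure_ageMeasure (Q := Q) hτ hτi
  have h1 : Tendsto (fun x : ℝ ↦ (ageMeasure Q τ).real (Set.Iio x) / ∫ s, τ s ∂Q) atTop (𝓝 1) := by
    have h0 : Tendsto (fun x : ℝ ↦ ageMeasure Q τ (Set.Iio x)) atTop
        (𝓝 (ageMeasure Q τ Set.univ)) := by
      rw [← Set.iUnion_Iio]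
      exact tendsto_measure_iUnion_atTop monotone_Iio
    have h := (ENNReal.tendsto_toReal (measure_ne_top (ageMeasure Q τ) Set.univ)).comp h0
    have h2 := h.div_const (∫ s, τ s ∂Q)
    rwa [← measureReal_def, ageMeasure_real_univ hτ hτ0, div_self hτp.ne'] at h2
  obtain ⟨x, hx⟩ := (h1.eventually (lt_mem_nhds (show 1 - ε < 1 by linarith))).exists
  obtain ⟨U, hU⟩ := eventually_atTop.1
    ((tendsto_measureReal_age_lt hτ hτ0 hna hτi hτp x).eventually (lt_mem_nhds hx))
  refine ⟨max 0 (max x U), le_max_left _ _, fun ℓ hℓ t ht ↦ ?_⟩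
  have hxℓ : x ≤ ℓ := (le_max_left _ _).trans ((le_max_right _ _).trans hℓ)
  have hUℓ : U ≤ ℓ := (le_max_right _ _).trans ((le_max_right _ _).trans hℓ)
  have h3 := hU (t + ℓ) (by linarith)
  have hm : MeasurableSet {w : ℕ → S | age τ (t + ℓ) w < x} :=
    measurableSet_lt (measurable_age_apply hτ _) measurable_const
  have h4 := probReal_compl_eq_one_sub (μ := Measure.infinitePi fun _ : ℕ ↦ Q) hm
  have h5 : (Measure.infinitePi fun _ : ℕ ↦ Q).real {w | ℓ ≤ age τ (t + ℓ) w} ≤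
      (Measure.infinitePi fun _ : ℕ ↦ Q).real {w | age τ (t + ℓ) w < x}ᶜ :=
    measureReal_mono fun w (hw : ℓ ≤ age τ (t + ℓ) w) ↦ by
      simpa using hxℓ.trans hw
  linarith

/-- **Asymptotic independence**: the mean of a product of bounded functionals of the process at
times which are large and far apart is close to the product of the limits of the means. By
induction on `m`: the deviation `G` of the last factors from their limit is small given a cycle
which ends long before the second time, so that `H`, which accounts for the cycles that last longer,
dominates `G` in the sense of `abs_cycleMean_le_cycleMean`. -/
theorem exists_forall_abs_integral_prod_sub_le (hτ : Measurable τ) (hτ0 : ∀ᵐ s ∂Q, 0 ≤ τ s)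
    (hna : ∀ d : ℝ, 0 < d → ¬ ∀ᵐ s ∂Q, ∃ k : ℤ, τ s = k * d)
    (hτi : Integrable τ Q) (hτp : 0 < ∫ s, τ s ∂Q) (m : ℕ) (c : Fin m → S → ℝ → ℝ)
    (hc : ∀ i, Measurable (Function.uncurry (c i))) (hb : ∀ i s t, |c i s t| ≤ 1) (L : Fin m → ℝ)
    (hL : ∀ i, Tendsto (cycleMean Q (cycleValue τ (c i))) atTop (𝓝 (L i))) (ε : ℝ) (hε : 0 < ε) :
    ∃ K, ∀ u : Fin m → ℝ, (∀ i, K ≤ u i) → (∀ i j, i < j → u i + K ≤ u j) →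
      |∫ w, ∏ i, cycleValue τ (c i) (u i) w ∂(Measure.infinitePi fun _ : ℕ ↦ Q) - ∏ i, L i|
        ≤ ε := by
  induction m generalizing ε with
  | zero => exact ⟨0, fun u _ _ ↦ by simp [hε.le]⟩
  | succ m ih =>
    set PP := Measure.infinitePi fun _ : ℕ ↦ Q
    have hprod : ∀ {n : ℕ} (x : Fin n → ℝ), (∀ i, |x i| ≤ 1) → |∏ i, x i| ≤ 1 := fun x hx ↦ by
      rw [Finset.abs_prod]
      exact Finset.prod_le_one (fun i _ ↦ abs_nonneg _) fun i _ ↦ hx i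
    have hL1 : ∀ i, |L i| ≤ 1 := fun i ↦
      le_of_tendsto (hL i).abs (.of_forall fun t ↦ abs_cycleMean_le (fun _ _ ↦ hb i _ _) t)
    set L' := ∏ i : Fin m, L i.succ with hL'
    have hL'1 : |L'| ≤ 1 := hprod _ fun i ↦ hL1 _
    set e := ε / 4 with he
    have he0 : 0 < e := by positivity
    obtain ⟨K', hK'⟩ := ih (fun i ↦ c i.succ) (fun i ↦ hc _) (fun i ↦ hb _) (fun i ↦ L i.succ)
      (fun i ↦ hL _) e he0
    obtain ⟨K₁, hK₁0, hK₁⟩ := exists_forall_measureReal_le_age hτ hτ0 hna hτi hτp he0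
    obtain ⟨K₀, hK₀⟩ := eventually_atTop.1 ((hL 0).eventually (Metric.closedBall_mem_nhds _ he0))
    set K := max (max 0 K₀) (max K' 0 + K₁) with hK
    have hK0 : 0 ≤ K := (le_max_left _ _).trans (le_max_left _ _)
    have hKK₀ : K₀ ≤ K := (le_max_right _ _).trans (le_max_left _ _)
    have hKK' : max K' 0 + K₁ ≤ K := le_max_right _ _
    -- a cycle which ends within `ℓ` after the first time ends at least `K'` before the others
    set ℓ := K - max K' 0 with hℓ
    have hℓK₁ : K₁ ≤ ℓ := by linarith
    have hℓ0 : 0 ≤ ℓ := hK₁0.trans hℓK₁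
    refine ⟨K, fun u hu hgap ↦ ?_⟩
    -- the gaps are kept fixed while the first time varies, so as to use the renewal equation
    set d : Fin m → ℝ := fun i ↦ u i.succ - u 0 with hd
    have hdK : ∀ i, K ≤ d i := fun i ↦ by
      have := hgap 0 i.succ (Fin.succ_pos i)
      rw [hd]; simp only; linarith
    -- the deviation of the last `m` factors, and the functional that dominates it
    set G : ℝ → (ℕ → S) → ℝ := fun t w ↦ cycleValue τ (c 0) t w *
      (∏ i : Fin m, cycleValue τ (c i.succ) (t + d i) w - L') with hG
    set H : ℝ → (ℕ → S) → ℝ := fun t w ↦ e + 2 * Set.indicator (Set.Ici ℓ) 1 (age τ (t + ℓ) w)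
      with hH
    have hpm : Measurable fun p : ℝ × (ℕ → S) ↦
        ∏ i : Fin m, cycleValue τ (c i.succ) (p.1 + d i) p.2 :=
      Finset.measurable_fun_prod _ fun i _ ↦ (measurable_cycleValue hτ (hc i.succ)).comp
        ((measurable_fst.add_const _).prodMk measurable_snd)
    have hGm : Measurable (Function.uncurry G) :=
      (measurable_cycleValue hτ (hc 0)).mul (hpm.sub_const _)
    have hHm : Measurable (Function.uncurry H) :=
      measurable_const.add (measurable_const.mul
        ((measurable_one.indicator measurableSet_Ici).comp ((measurable_age hτ).comp
          ((measurable_fst.add_const _).prodMk measurable_snd))))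
    have hG2 : ∀ t w, |G t w| ≤ 2 := fun t w ↦ by
      rw [hG]; simp only
      rw [abs_mul]
      have h1 := abs_sub (∏ i : Fin m, cycleValue τ (c i.succ) (t + d i) w) L'
      have h2 : |∏ i : Fin m, cycleValue τ (c i.succ) (t + d i) w| ≤ 1 := hprod _ fun i ↦ hb _ _ _
      have h3 : |cycleValue τ (c 0) t w| ≤ 1 := hb _ _ _
      calc _ ≤ 1 * 2 := mul_le_mul h3 (by linarith) (abs_nonneg _) zero_le_one
        _ = 2 := one_mul _
    have hind : ∀ x : ℝ, 0 ≤ Set.indicator (Set.Ici ℓ) (1 : ℝ → ℝ) x ∧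
        Set.indicator (Set.Ici ℓ) (1 : ℝ → ℝ) x ≤ 1 := fun x ↦ by
      by_cases h : ℓ ≤ x <;> simp [h]
    have hH2 : ∀ t w, |H t w| ≤ e + 2 := fun t w ↦ by
      have := hind (age τ (t + ℓ) w)
      rw [hH]; simp only
      rw [abs_of_nonneg (by linarith)]
      linarith
    have hmain := abs_cycleMean_le_cycleMean (Q := Q) hτ hτ0 hτi hτp hGm hHm hG2 hH2
      (fun s w t hs hw hst ↦ by
        have hdt : ∀ i, τ s ≤ t + d i := fun i ↦ by linarith [hdK i]
        rw [hG]; simp only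
        rw [hw.cycleValue_consCycle hs hst]
        simp_rw [fun i ↦ hw.cycleValue_consCycle hs (hdt i) (c i.succ), add_sub_right_comm])
      (fun s w t hs hw hst ↦ by
        rw [hH]; simp only
        rw [hw.age_consCycle hs (by linarith), add_sub_right_comm])
      (fun s t ht hst ↦ by
        have hs : 0 ≤ τ s := ht.trans hst.le
        have hproper := ae_isProper hτ hτ0 hτi hτp
        have hHint : Integrable (fun w ↦ H t (consCycle s w)) PP :=
          integrable_of_abs_le ((hHm.comp (measurable_const.prodMk measurable_id)).comp
            (measurable_consCycle.comp (measurable_const.prodMk measurable_id)))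
            fun w ↦ hH2 t _
        rcases lt_or_ge (t + ℓ) (τ s) with hlt | hge
        · -- the first cycle lasts beyond `t + ℓ`
          refine (abs_integral_le_of_abs_le fun w ↦ hG2 t _).trans ?_
          have : ∫ _, (2 : ℝ) ∂PP ≤ ∫ w, H t (consCycle s w) ∂PP := by
            refine integral_mono_ae (integrable_const _) hHint ?_
            filter_upwards [hproper] with w hw
            rw [hH]; simp only
            rw [(hw.cons hs).age_of_lt (by linarith) hlt,
              Set.indicator_of_mem (by simpa using ht)]
            simp only [Pi.one_apply]; linarith
          simpa using this
        · -- a new cycle starts long before `t + d i`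
          have hdt : ∀ i, τ s + max K' 0 ≤ t + d i := fun i ↦ by linarith [hdK i]
          have hK'0 : 0 ≤ max K' 0 := le_max_right _ _
          have hK'm : K' ≤ max K' 0 := le_max_left _ _
          have hint : Integrable
              (fun w ↦ ∏ i : Fin m, cycleValue τ (c i.succ) (t + d i - τ s) w) PP :=
            integrable_of_abs_le (Finset.measurable_fun_prod _ fun i _ ↦
              (measurable_cycleValue hτ (hc i.succ)).comp
                (measurable_const.prodMk measurable_id)) fun w ↦ hprod _ fun i ↦ hb _ _ _
          have e1 : ∫ w, G t (consCycle s w) ∂PP = c 0 s t *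
              (∫ w, ∏ i : Fin m, cycleValue τ (c i.succ) (t + d i - τ s) w ∂PP - L') := by
            have e2 : ∫ w, (∏ i : Fin m, cycleValue τ (c i.succ) (t + d i - τ s) w - L') ∂PP =
                ∫ w, ∏ i : Fin m, cycleValue τ (c i.succ) (t + d i - τ s) w ∂PP - L' := by
              rw [integral_sub hint (integrable_const _)]; simp
            rw [← e2, ← integral_const_mul]
            refine integral_congr_ae ?_
            filter_upwards [hproper] with w hw
            rw [hG]; simp only
            rw [(hw.cons hs).cycleValue_of_lt ht hst, consCycle_zero]
            simp_rw [fun i ↦ hw.cycleValue_consCycle hs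
              (show τ s ≤ t + d i by linarith [hdt i]) (c i.succ)]
          have e3 := hK' (fun i ↦ t + d i - τ s) (fun i ↦ by linarith [hdt i]) fun i j hij ↦ by
            have := hgap i.succ j.succ (Fin.succ_lt_succ_iff.2 hij)
            rw [hd]; simp only; linarith
          calc |∫ w, G t (consCycle s w) ∂PP| ≤ 1 * e := by
                rw [e1, abs_mul]
                exact mul_le_mul (hb 0 s t) e3 (abs_nonneg _) zero_le_one
            _ = ∫ _, e ∂PP := by simp
            _ ≤ ∫ w, H t (consCycle s w) ∂PP := by
                refine integral_mono (integrable_const _) hHint fun w ↦ ?_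
                have := (hind (age τ (t + ℓ) (consCycle s w))).1
                rw [hH]; simp only; linarith) (u 0)
    -- evaluate both means at time `u 0`
    have hu0 : 0 ≤ u 0 := hK0.trans (hu 0)
    have hsucc : ∀ i : Fin m, u 0 + d i = u i.succ := fun i ↦ by rw [hd]; ring
    have hHle : cycleMean Q H (u 0) ≤ 3 * e := by
      have hm : MeasurableSet {w : ℕ → S | ℓ ≤ age τ (u 0 + ℓ) w} :=
        measurableSet_le measurable_const (measurable_age_apply hτ _)
      have h1 : ∫ w, Set.indicator (Set.Ici ℓ) (1 : ℝ → ℝ) (age τ (u 0 + ℓ) w) ∂PP =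
          PP.real {w | ℓ ≤ age τ (u 0 + ℓ) w} := by
        rw [← integral_indicator_one hm]; rfl
      have h2 : Integrable (fun w ↦ Set.indicator (Set.Ici ℓ) (1 : ℝ → ℝ) (age τ (u 0 + ℓ) w)) PP :=
        integrable_of_abs_le ((measurable_one.indicator measurableSet_Ici).comp
          (measurable_age_apply hτ _)) (b := 1) fun w ↦ by
            rw [abs_of_nonneg (hind _).1]; exact (hind _).2
      rw [cycleMean_of_nonneg hu0, hH]
      simp only
      rw [integral_add (integrable_const _) (h2.const_mul _), integral_const_mul, h1]
      have := hK₁ ℓ hℓK₁ (u 0) hu0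
      simp only [integral_const, probReal_univ, smul_eq_mul, one_mul]
      linarith
    have hGeq : cycleMean Q G (u 0) = ∫ w, ∏ i, cycleValue τ (c i) (u i) w ∂PP -
        L' * cycleMean Q (cycleValue τ (c 0)) (u 0) := by
      have i1 : Integrable (fun w ↦ ∏ i, cycleValue τ (c i) (u i) w) PP :=
        integrable_of_abs_le (Finset.measurable_fun_prod _ fun i _ ↦
          (measurable_cycleValue hτ (hc i)).comp
            (measurable_const.prodMk measurable_id)) fun w ↦ hprod _ fun i ↦ hb _ _ _
      have i2 : Integrable (fun w ↦ cycleValue τ (c 0) (u 0) w) PP :=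
        integrable_of_abs_le ((measurable_cycleValue hτ (hc 0)).comp
          (measurable_const.prodMk measurable_id)) fun w ↦ hb _ _ _
      rw [cycleMean_of_nonneg hu0, cycleMean_of_nonneg hu0, ← integral_const_mul,
        ← integral_sub i1 (i2.const_mul _)]
      refine integral_congr_ae (.of_forall fun w ↦ ?_)
      simp only [hG, hsucc, Fin.prod_univ_succ]
      ring
    have hZ := hK₀ (u 0) (hKK₀.trans (hu 0))
    rw [Real.dist_eq] at hZ
    rw [Fin.prod_univ_succ, ← hL']
    have h1 : |L' * (cycleMean Q (cycleValue τ (c 0)) (u 0) - L 0)| ≤ 1 * e := by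
      rw [abs_mul]
      exact mul_le_mul hL'1 hZ (abs_nonneg _) zero_le_one
    have h2 : ∫ w, ∏ i, cycleValue τ (c i) (u i) w ∂PP - L 0 * L' =
        cycleMean Q G (u 0) + L' * (cycleMean Q (cycleValue τ (c 0)) (u 0) - L 0) := by
      rw [hGeq]; ring
    rw [h2]
    refine (abs_add_le _ _).trans ?_
    linarith

end MultiDim


/-! ### Evaluation of right-continuous paths at random times -/

section UpperApprox

/-- The approximation `(⌊r (k + 1)⌋₊ + 1) / (k + 1)` of the positive part of `r` from the right.
It takes countably many values. -/
noncomputable def upperApprox (k : ℕ) (r : ℝ) : ℝ≥0 := ((⌊r * (k + 1)⌋₊ + 1 : ℕ) : ℝ≥0) / (k + 1)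

theorem tendsto_upperApprox (r : ℝ) :
    Tendsto (fun k ↦ upperApprox k r) atTop (𝓝[≥] r.toNNReal) := by
  have h0 : ∀ k : ℕ, (0 : ℝ) < k + 1 := fun k ↦ by positivity
  have hcoe : ∀ k, (upperApprox k r : ℝ) = ((⌊r * (k + 1)⌋₊ : ℝ) + 1) / (k + 1) := fun k ↦ by
    simp [upperApprox]
  have hle : ∀ k, (r.toNNReal : ℝ) ≤ upperApprox k r := fun k ↦ by
    rw [hcoe, Real.coe_toNNReal', le_div_iff₀ (h0 k)]
    rcases le_total 0 r with hr | hr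
    · rw [max_eq_left hr]; exact (Nat.lt_floor_add_one _).le
    · rw [max_eq_right hr]; simp; positivity
  have hge : ∀ k, (upperApprox k r : ℝ) ≤ r.toNNReal + 1 / ((k : ℝ) + 1) := fun k ↦ by
    rw [hcoe, Real.coe_toNNReal', div_le_iff₀ (h0 k), add_mul, one_div_mul_cancel (h0 k).ne']
    gcongr
    rcases le_total 0 r with hr | hr
    · rw [max_eq_left hr]; exact Nat.floor_le (mul_nonneg hr (h0 k).le)
    · rw [max_eq_right hr, Nat.floor_of_nonpos (mul_nonpos_of_nonpos_of_nonneg hr (h0 k).le)]; simp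
  refine tendsto_nhdsWithin_iff.2 ⟨?_, .of_forall fun k ↦ NNReal.coe_le_coe.1 (hle k)⟩
  rw [← NNReal.tendsto_coe]
  have h1 : Tendsto (fun k : ℕ ↦ (r.toNNReal : ℝ) + 1 / ((k : ℝ) + 1)) atTop
      (𝓝 ((r.toNNReal : ℝ) + 0)) :=
    tendsto_const_nhds.add tendsto_one_div_add_atTop_nhds_zero_nat
  rw [add_zero] at h1
  exact tendsto_of_tendsto_of_tendsto_of_le_of_le tendsto_const_nhds h1 hle hge

theorem measurable_apply_nat {A B : Type*} [MeasurableSpace A] [MeasurableSpace B]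
    {F : ℕ → A → B} (hF : ∀ n, Measurable (F n)) {g : A → ℕ} (hg : Measurable g) :
    Measurable fun a ↦ F (g a) a :=
  (measurable_from_prod_countable_right (f := fun p : ℕ × A ↦ F p.1 p.2) hF).comp
    (hg.prodMk measurable_id)

theorem measurable_comp_upperApprox {A B : Type*} [MeasurableSpace A] [MeasurableSpace B]
    {F : ℝ≥0 → A → B} (hF : ∀ s, Measurable (F s)) {r : A → ℝ} (hr : Measurable r) (k : ℕ) :
    Measurable fun a ↦ F (upperApprox k (r a)) a := by
  have h := measurable_apply_nat (fun n : ℕ ↦ hF (((n + 1 : ℕ) : ℝ≥0) / (k + 1)))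
    (Nat.measurable_floor.comp (hr.mul_const ((k : ℝ) + 1)))
  simpa only [upperApprox, Function.comp_apply] using h

theorem ContinuousWithinAt.tendsto_upperApprox {E : Type*} [TopologicalSpace E] {x : ℝ≥0 → E}
    {r : ℝ} (hx : ContinuousWithinAt x (Set.Ici r.toNNReal) r.toNNReal) :
    Tendsto (fun k ↦ x (upperApprox k r)) atTop (𝓝 (x r.toNNReal)) :=
  Tendsto.comp hx (_root_.tendsto_upperApprox r)

end UpperApprox

section PathKernel

variable {E : Type*} [MetricSpace E]

/-- The kernel `((x, T), r) ↦ f (x r)` on the space of cycles, a cycle being a path with its length.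
Evaluation of a path at `r` is not measurable jointly in the path and `r` for the product
`σ`-algebra; the upper limit along a sequence decreasing to `r` is, and coincides with it for right
continuous paths. -/
noncomputable def pathKernel (f : E →ᵇ ℝ) (s : (ℝ≥0 → E) × ℝ) (r : ℝ) : ℝ :=
  limsup (fun k ↦ f (s.1 (upperApprox k r))) atTop

theorem measurable_pathKernel [MeasurableSpace E] [BorelSpace E] (f : E →ᵇ ℝ) :
    Measurable (Function.uncurry (pathKernel f)) := by
  refine Measurable.limsup fun k ↦ ?_
  exact measurable_comp_upperApprox (A := ((ℝ≥0 → E) × ℝ) × ℝ) (F := fun s p ↦ f (p.1.1 s))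
    (fun s ↦ f.continuous.measurable.comp
      ((measurable_pi_apply s).comp (measurable_fst.comp measurable_fst))) measurable_snd k

theorem abs_pathKernel_le (f : E →ᵇ ℝ) (s : (ℝ≥0 → E) × ℝ) (r : ℝ) :
    |pathKernel f s r| ≤ ‖f‖ := by
  have h := fun k ↦ abs_le.1 (f.norm_coe_le_norm (s.1 (upperApprox k r)))
  have h1 : IsBoundedUnder (· ≤ ·) atTop fun k ↦ f (s.1 (upperApprox k r)) :=
    isBoundedUnder_of ⟨_, fun k ↦ (h k).2⟩
  have h2 : IsBoundedUnder (· ≥ ·) atTop fun k ↦ f (s.1 (upperApprox k r)) :=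
    isBoundedUnder_of ⟨_, fun k ↦ (h k).1⟩
  refine abs_le.2 ⟨le_limsup_of_le h1 fun b hb ↦ ?_, limsup_le_of_le h2.isCoboundedUnder_le
    (.of_forall fun k ↦ (h k).2)⟩
  obtain ⟨k, hk⟩ := hb.exists
  exact (h k).1.trans hk

theorem pathKernel_eq (f : E →ᵇ ℝ) {s : (ℝ≥0 → E) × ℝ} {r : ℝ}
    (hs : ContinuousWithinAt s.1 (Set.Ici r.toNNReal) r.toNNReal) :
    pathKernel f s r = f (s.1 r.toNNReal) :=
  ((f.continuous.tendsto _).comp hs.tendsto_upperApprox).limsup_eq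

end PathKernel

/-! ### The process as a functional of its cycles -/

section Cycles

variable {Ω E : Type*} {C : ℕ → ℝ≥0 → Ω → E} {T : ℕ → Ω → ℝ}

/-- The sequence of cycles, each a path with its length. -/
def cycleSeq (C : ℕ → ℝ≥0 → Ω → E) (T : ℕ → Ω → ℝ) (ω : Ω) (n : ℕ) : (ℝ≥0 → E) × ℝ :=
  (fun s ↦ C n s ω, T n ω)

theorem regenCount_eq_cycleIndex {t : ℝ} (ht : 0 ≤ t) (ω : Ω) :
    regenCount T t.toNNReal ω = cycleIndex Prod.snd t (cycleSeq C T ω) := by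
  rw [regenCount, cycleIndex, Real.coe_toNNReal t ht]; rfl

theorem regenPath_eq {t : ℝ} (ht : 0 ≤ t) (ω : Ω) :
    regenPath C T t.toNNReal ω = (cycleSeq C T ω (cycleIndex Prod.snd t (cycleSeq C T ω))).1
      (age Prod.snd t (cycleSeq C T ω)).toNNReal := by
  rw [regenPath, regenCount_eq_cycleIndex (C := C) ht, Real.coe_toNNReal t ht]; rfl

variable [MeasurableSpace Ω] [MetricSpace E] [MeasurableSpace E] {P : Measure Ω} {X : ℝ≥0 → Ω → E}

/-- The law of a cycle. -/
noncomputable def cycleLaw (P : Measure Ω) (C : ℕ → ℝ≥0 → Ω → E) (T : ℕ → Ω → ℝ) :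
    Measure ((ℝ≥0 → E) × ℝ) :=
  P.map fun ω ↦ cycleSeq C T ω 0

namespace IsRegenerative

theorem measurable_cycleSeq_apply (hX : IsRegenerative P X C T) (n : ℕ) :
    Measurable fun ω ↦ cycleSeq C T ω n :=
  (measurable_pi_iff.2 fun s ↦ hX.measurable_cycle n s).prodMk (hX.measurable_length n)

theorem measurable_cycleSeq (hX : IsRegenerative P X C T) : Measurable (cycleSeq C T) :=
  measurable_pi_iff.2 fun n ↦ hX.measurable_cycleSeq_apply n

theorem isProbabilityMeasure_cycleLaw [IsProbabilityMeasure P] (hX : IsRegenerative P X C T) :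
    IsProbabilityMeasure (cycleLaw P C T) :=
  Measure.isProbabilityMeasure_map (hX.measurable_cycleSeq_apply 0).aemeasurable

/-- The sequence of cycles is i.i.d. -/
theorem map_cycleSeq (hX : IsRegenerative P X C T) :
    P.map (cycleSeq C T) = Measure.infinitePi fun _ : ℕ ↦ cycleLaw P C T := by
  have h := hX.indep.map_fun_eq_infinitePi_map hX.measurable_cycleSeq_apply
  have h2 : ∀ n, P.map (fun ω ↦ ((fun s ↦ C n s ω : ℝ≥0 → E), T n ω)) = cycleLaw P C T := fun n ↦
    (hX.identDistrib n).map_eq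
  exact h.trans (congrArg _ (funext h2))

theorem ae_length_nonneg (hX : IsRegenerative P X C T) : ∀ᵐ s ∂(cycleLaw P C T), 0 ≤ s.2 :=
  (ae_map_iff (hX.measurable_cycleSeq_apply 0).aemeasurable
    (measurableSet_le measurable_const measurable_snd)).2 (hX.length_nonneg 0)

theorem not_arithmetic (hX : IsRegenerative P X C T)
    (hna : ¬ IsArithmetic (P.map (T 0))) (d : ℝ) (hd : 0 < d) :
    ¬ ∀ᵐ s ∂(cycleLaw P C T), ∃ k : ℤ, s.2 = k * d := by
  intro h
  refine hna ⟨d, hd, ?_⟩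
  have hm : MeasurableSet {x : ℝ | ∃ k : ℤ, x = k * d} := by
    have : {x : ℝ | ∃ k : ℤ, x = k * d} = Set.range fun k : ℤ ↦ (k : ℝ) * d := by
      ext x; simp [eq_comm]
    rw [this]
    exact (Set.countable_range _).measurableSet
  exact (ae_map_iff (hX.measurable_length 0).aemeasurable hm).2
    (ae_of_ae_map (hX.measurable_cycleSeq_apply 0).aemeasurable h)

theorem integrable_length (hX : IsRegenerative P X C T) (hi : Integrable (T 0) P) :
    Integrable Prod.snd (cycleLaw P C T) :=
  (integrable_map_measure measurable_snd.aestronglyMeasurable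
    (hX.measurable_cycleSeq_apply 0).aemeasurable).2 hi

theorem integral_length (hX : IsRegenerative P X C T) :
    ∫ s, s.2 ∂(cycleLaw P C T) = ∫ ω, T 0 ω ∂P :=
  integral_map (hX.measurable_cycleSeq_apply 0).aemeasurable measurable_snd.aestronglyMeasurable

/-- The value of the process, observed through `f`, is a functional of the sequence of cycles. -/
theorem ae_eq_cycleValue (hX : IsRegenerative P X C T) (f : E →ᵇ ℝ) :
    ∀ᵐ ω ∂P, ∀ t ≥ 0, f (X t.toNNReal ω) =
      cycleValue Prod.snd (pathKernel f) t (cycleSeq C T ω) := by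
  filter_upwards [hX.eq_path, ae_all_iff.2 hX.rightContinuous] with ω h1 h2 t ht
  rw [h1, regenPath_eq ht, cycleValue, pathKernel_eq]
  exact h2 _ _

theorem aemeasurable_apply [BorelSpace E] (hX : IsRegenerative P X C T) (t : ℝ≥0) :
    AEMeasurable (X t) P := by
  have hm : Measurable fun ω ↦ cycleIndex Prod.snd (t : ℝ) (cycleSeq C T ω) :=
    (measurable_cycleIndex measurable_snd).comp (measurable_const.prodMk hX.measurable_cycleSeq)
  have ha : Measurable fun ω ↦ age Prod.snd (t : ℝ) (cycleSeq C T ω) :=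
    (measurable_age measurable_snd).comp (measurable_const.prodMk hX.measurable_cycleSeq)
  have hC : ∀ s, Measurable fun p : ℕ × Ω ↦ C p.1 s p.2 := fun s ↦
    measurable_from_prod_countable_right fun n ↦ hX.measurable_cycle n s
  refine aemeasurable_of_tendsto_metrizable_ae (u := atTop)
    (f := fun k ω ↦ C (cycleIndex Prod.snd (t : ℝ) (cycleSeq C T ω))
      (upperApprox k (age Prod.snd (t : ℝ) (cycleSeq C T ω))) ω)
    (fun k ↦ (measurable_comp_upperApprox (F := fun s ω ↦
      C (cycleIndex Prod.snd (t : ℝ) (cycleSeq C T ω)) s ω)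
      (fun s ↦ (hC s).comp (hm.prodMk measurable_id)) ha k).aemeasurable) ?_
  filter_upwards [hX.eq_path, ae_all_iff.2 hX.rightContinuous] with ω h1 h2
  have h3 := regenPath_eq (C := C) (T := T) t.coe_nonneg ω
  rw [Real.toNNReal_coe] at h3
  rw [h1, h3]
  exact (h2 _ _).tendsto_upperApprox

/-- Almost surely `pathKernel` is evaluation of the path, so that the contribution of the first
cycle can be computed on the original probability space. -/
theorem firstCycleMean_eq [BorelSpace E] (hX : IsRegenerative P X C T) (f : E →ᵇ ℝ) (t : ℝ) :
    firstCycleMean (cycleLaw P C T) Prod.snd (pathKernel f) t =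
      firstCycleMean P (T 0) (fun ω r ↦ f (C 0 r.toNNReal ω)) t := by
  have hk : Measurable fun s : (ℝ≥0 → E) × ℝ ↦ pathKernel f s t :=
    (measurable_pathKernel f).of_uncurry_right
  rw [firstCycleMean, cycleLaw, integral_map (hX.measurable_cycleSeq_apply 0).aemeasurable
    (hk.indicator (measurableSet_lt measurable_const measurable_snd)).aestronglyMeasurable,
    firstCycleMean]
  refine integral_congr_ae ?_
  filter_upwards [hX.rightContinuous 0] with ω hω
  have h := pathKernel_eq f (s := cycleSeq C T ω 0) (r := t) (hω _)
  by_cases ht : t < T 0 ω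
  · rw [Set.indicator_of_mem (s := {s : (ℝ≥0 → E) × ℝ | t < s.2}) ht,
      Set.indicator_of_mem (s := {ω | t < T 0 ω}) ht, h]; rfl
  · rw [Set.indicator_of_notMem (s := {s : (ℝ≥0 → E) × ℝ | t < s.2}) ht,
      Set.indicator_of_notMem (s := {ω | t < T 0 ω}) ht]

theorem continuousWithinAt_firstCycleMean [BorelSpace E] [IsProbabilityMeasure P]
    (hX : IsRegenerative P X C T)
    (f : E →ᵇ ℝ) (t : ℝ) :
    ContinuousWithinAt (firstCycleMean (cycleLaw P C T) Prod.snd (pathKernel f)) (Set.Ici t) t := by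
  rw [funext (hX.firstCycleMean_eq f)]
  refine _root_.continuousWithinAt_firstCycleMean (hX.measurable_length 0)
    (fun t ↦ f.continuous.measurable.comp (hX.measurable_cycle 0 _)) (b := ‖f‖)
    (fun ω r ↦ f.norm_coe_le_norm _) ?_
  filter_upwards [hX.rightContinuous 0] with ω hω
  exact f.continuous.continuousAt.comp_continuousWithinAt
    ((hω _).comp continuous_real_toNNReal.continuousWithinAt
      fun u hu ↦ Real.toNNReal_le_toNNReal hu)

/-- The limit law of a regenerative process: the law of a point of the first cycle chosen uniformly
in time, `A ↦ E ∫₀^T 1_A (C 0 t) dt / E T`. -/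
noncomputable def _root_.stationaryLaw (P : Measure Ω) (C : ℕ → ℝ≥0 → Ω → E) (T : ℕ → Ω → ℝ) :
    Measure E :=
  ENNReal.ofReal (∫ ω, T 0 ω ∂P)⁻¹ •
    ((P.prod volume).restrict {p : Ω × ℝ | 0 ≤ p.2 ∧ p.2 < T 0 p.1}).map
      fun p ↦ C 0 p.2.toNNReal p.1

theorem aemeasurable_cycle_prod [BorelSpace E] (hX : IsRegenerative P X C T) (ρ : Measure (Ω × ℝ))
    (hρ : ρ ≪ P.prod volume) : AEMeasurable (fun p : Ω × ℝ ↦ C 0 p.2.toNNReal p.1) ρ := by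
  refine aemeasurable_of_tendsto_metrizable_ae (u := atTop)
    (f := fun k (p : Ω × ℝ) ↦ C 0 (upperApprox k p.2) p.1)
    (fun k ↦ (measurable_comp_upperApprox (F := fun s (p : Ω × ℝ) ↦ C 0 s p.1)
      (fun s ↦ (hX.measurable_cycle 0 s).comp measurable_fst) measurable_snd k).aemeasurable) ?_
  refine hρ.ae_le ?_
  filter_upwards [Measure.quasiMeasurePreserving_fst.ae (hX.rightContinuous 0)] with p hp
  exact (hp _).tendsto_upperApprox

theorem isProbabilityMeasure_stationaryLaw [BorelSpace E] [IsProbabilityMeasure P]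
    (hX : IsRegenerative P X C T)
    (hi : Integrable (T 0) P) (hp : 0 < ∫ ω, T 0 ω ∂P) :
    IsProbabilityMeasure (stationaryLaw P C T) := by
  constructor
  rw [stationaryLaw, Measure.smul_apply, Measure.map_apply_of_aemeasurable
    (hX.aemeasurable_cycle_prod _ Measure.restrict_le_self.absolutelyContinuous) .univ,
    Set.preimage_univ, Measure.restrict_apply_univ, prod_underGraph (hX.measurable_length 0),
    ← ofReal_integral_eq_lintegral_ofReal hi (hX.length_nonneg 0), smul_eq_mul,
    ← ENNReal.ofReal_mul (inv_nonneg.2 hp.le), inv_mul_cancel₀ hp.ne', ENNReal.ofReal_one]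

theorem integral_stationaryLaw [BorelSpace E] [IsProbabilityMeasure P]
    (hX : IsRegenerative P X C T)
    (hi : Integrable (T 0) P) (hp : 0 < ∫ ω, T 0 ω ∂P) (f : E →ᵇ ℝ) :
    ∫ x, f x ∂(stationaryLaw P C T) =
      (∫ t in Set.Ici 0, firstCycleMean P (T 0) (fun ω r ↦ f (C 0 r.toNNReal ω)) t) /
        ∫ ω, T 0 ω ∂P := by
  have hm := hX.aemeasurable_cycle_prod
    ((P.prod volume).restrict {p : Ω × ℝ | 0 ≤ p.2 ∧ p.2 < T 0 p.1})
    Measure.restrict_le_self.absolutelyContinuous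
  have hT := hX.measurable_length 0
  have hfm : AEStronglyMeasurable (fun p : Ω × ℝ ↦ f (C 0 p.2.toNNReal p.1))
      ((P.prod volume).restrict {p : Ω × ℝ | 0 ≤ p.2 ∧ p.2 < T 0 p.1}) :=
    (f.continuous.measurable.comp_aemeasurable hm).aestronglyMeasurable
  rw [stationaryLaw, integral_smul_measure, ENNReal.toReal_ofReal (inv_nonneg.2 hp.le), smul_eq_mul,
    ← div_eq_inv_mul, integral_map hm f.continuous.measurable.aestronglyMeasurable,
    ← integral_indicator (measurableSet_underGraph hT),
    integral_prod_symm _ (integrable_indicator_underGraph hT hi hfm (b := ‖f‖)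
      fun p ↦ f.norm_coe_le_norm _), ← integral_indicator measurableSet_Ici]
  congr 2 with t
  by_cases ht : 0 ≤ t
  · rw [Set.indicator_of_mem (Set.mem_Ici.2 ht), firstCycleMean]
    congr 1 with ω
    by_cases h : t < T 0 ω <;> simp [h, ht]
  · rw [Set.indicator_of_notMem (by simpa using ht)]
    simp [ht]

end IsRegenerative

end Cycles


/-! ### Convergence at several times -/

section Final

variable {Ω E : Type*} [MeasurableSpace Ω] [MetricSpace E] [MeasurableSpace E]
  [BorelSpace E] {P : Measure Ω} [IsProbabilityMeasure P]
  {X : ℝ≥0 → Ω → E} {C : ℕ → ℝ≥0 → Ω → E} {T : ℕ → Ω → ℝ}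

theorem eventually_add_le {a b a' b' : ℝ} (h : a < a') (K : ℝ) :
    ∀ᶠ t in atTop, a * t + b + K ≤ a' * t + b' := by
  have h1 : Tendsto (fun t : ℝ ↦ (a' - a) * t) atTop atTop :=
    tendsto_id.const_mul_atTop (sub_pos.2 h)
  filter_upwards [h1.eventually_ge_atTop (b + K - b')] with t ht
  linarith

/-- Asymptotic independence, observed through functions bounded by `1`. The times are first put in
increasing order. -/
theorem IsRegenerative.tendsto_integral_prod_of_norm_le_one (hX : IsRegenerative P X C T)
    (hna : ¬ IsArithmetic (P.map (T 0))) (hi : Integrable (T 0) P) (hp : 0 < ∫ ω, T 0 ω ∂P)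
    {m : ℕ} {α β : Fin m → ℝ} (hα : ∀ i, 0 < α i) (hα' : ∀ i j, i ≠ j → α i ≠ α j)
    (f : Fin m → E →ᵇ ℝ) (hf : ∀ i, ‖f i‖ ≤ 1) :
    Tendsto (fun t ↦ ∫ ω, ∏ i, f i (X (α i * t + β i).toNNReal ω) ∂P) atTop
      (𝓝 (∏ i, ∫ x, f i x ∂(stationaryLaw P C T))) := by
  have hQ := hX.isProbabilityMeasure_cycleLaw
  have hkb : ∀ (i : Fin m) s r, |pathKernel (f i) s r| ≤ 1 := fun i s r ↦
    (abs_pathKernel_le (f i) s r).trans (hf i)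
  have hp' : 0 < ∫ s, s.2 ∂(cycleLaw P C T) := by rwa [hX.integral_length]
  have hlim : ∀ i, Tendsto (cycleMean (cycleLaw P C T) (cycleValue Prod.snd (pathKernel (f i))))
      atTop (𝓝 (∫ x, f i x ∂(stationaryLaw P C T))) := by
    intro i
    have h := tendsto_cycleMean measurable_snd hX.ae_length_nonneg (hX.not_arithmetic hna)
      (hX.integrable_length hi) hp' (measurable_pathKernel (f i)) (hkb i)
      (fun t _ ↦ hX.continuousWithinAt_firstCycleMean (f i) t)
    rw [hX.integral_stationaryLaw hi hp (f i)]
    simp_rw [hX.firstCycleMean_eq (f i), hX.integral_length] at h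
    exact h
  set σ := Tuple.sort α
  have hmono : StrictMono (α ∘ σ) :=
    (Tuple.monotone_sort α).strictMono_of_injective
      ((show Function.Injective α from fun i j h ↦ by
        by_contra hne; exact hα' i j hne h).comp σ.injective)
  rw [Metric.tendsto_nhds]
  intro ε hε
  obtain ⟨K, hK⟩ := exists_forall_abs_integral_prod_sub_le measurable_snd hX.ae_length_nonneg
    (hX.not_arithmetic hna) (hX.integrable_length hi) hp' m (fun i ↦ pathKernel (f (σ i)))
    (fun i ↦ measurable_pathKernel _) (fun i ↦ hkb _) _ (fun i ↦ hlim (σ i)) (ε / 2) (half_pos hε)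
  have e1 : ∀ᶠ t in atTop, ∀ i, max K 0 ≤ α (σ i) * t + β (σ i) :=
    eventually_all.2 fun i ↦ by
      simpa using eventually_add_le (b := 0) (b' := β (σ i)) (hα (σ i)) (max K 0)
  have e2 : ∀ᶠ t in atTop, ∀ i j, i < j →
      α (σ i) * t + β (σ i) + K ≤ α (σ j) * t + β (σ j) :=
    eventually_all.2 fun i ↦ eventually_all.2 fun j ↦ by
      by_cases hij : i < j
      · exact (eventually_add_le (hmono hij) K).mono fun t ht _ ↦ ht
      · exact .of_forall fun t h ↦ absurd h hij
  filter_upwards [e1, e2] with t h1 h2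
  have h3 := hK (fun i ↦ α (σ i) * t + β (σ i)) (fun i ↦ (le_max_left _ _).trans (h1 i)) h2
  rw [Real.dist_eq]
  refine lt_of_le_of_lt ?_ (half_lt_self hε)
  refine (congrArg abs (congrArg₂ (· - ·) ?_ ?_)).trans_le h3
  · rw [← hX.map_cycleSeq, integral_map hX.measurable_cycleSeq.aemeasurable
      (Finset.measurable_fun_prod _ fun i _ ↦ (measurable_cycleValue measurable_snd
        (measurable_pathKernel _)).of_uncurry_left).aestronglyMeasurable]
    refine integral_congr_ae ?_
    filter_upwards [ae_all_iff.2 fun i ↦ hX.ae_eq_cycleValue (f i)] with ω hω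
    rw [← Equiv.prod_comp σ]
    exact Finset.prod_congr rfl fun i _ ↦ hω _ _ ((le_max_right _ _).trans (h1 i))
  · exact (Equiv.prod_comp σ fun i ↦ ∫ x, f i x ∂(stationaryLaw P C T)).symm

/-- Asymptotic independence, in terms of products of bounded continuous functions. -/
theorem IsRegenerative.tendsto_integral_prod (hX : IsRegenerative P X C T)
    (hna : ¬ IsArithmetic (P.map (T 0))) (hi : Integrable (T 0) P) (hp : 0 < ∫ ω, T 0 ω ∂P)
    {m : ℕ} {α β : Fin m → ℝ} (hα : ∀ i, 0 < α i) (hα' : ∀ i j, i ≠ j → α i ≠ α j)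
    (f : Fin m → E →ᵇ ℝ) :
    Tendsto (fun t ↦ ∫ ω, ∏ i, f i (X (α i * t + β i).toNNReal ω) ∂P) atTop
      (𝓝 (∏ i, ∫ x, f i x ∂(stationaryLaw P C T))) := by
  set b : Fin m → ℝ := fun i ↦ ‖f i‖ + 1 with hb
  have hb0 : ∀ i, 0 < b i := fun i ↦ by positivity
  set g : Fin m → E →ᵇ ℝ := fun i ↦ (b i)⁻¹ • f i with hg
  have hg1 : ∀ i, ‖g i‖ ≤ 1 := fun i ↦ by
    rw [hg]; simp only
    rw [norm_smul, norm_inv, Real.norm_of_nonneg (hb0 i).le, inv_mul_le_iff₀ (hb0 i), mul_one]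
    simp [hb]
  have hfg : ∀ i x, f i x = b i * g i x := fun i x ↦ by
    simp [hg, mul_inv_cancel_left₀ (hb0 i).ne']
  have h := (hX.tendsto_integral_prod_of_norm_le_one hna hi hp hα hα' (β := β) g hg1).const_mul
    (∏ i, b i)
  simp_rw [hfg, Finset.prod_mul_distrib, integral_const_mul, Finset.prod_mul_distrib]
  exact h

end Final

/-! ### Weak convergence to a product measure -/

section Product

open Set in
/-- Convergence of the means of products of bounded continuous functions of the coordinates implies
weak convergence to the product measure: it gives convergence of the measures of the boxes whose
sides have null boundary, and these form a `π`-system containing small neighborhoods of every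
point. -/
theorem tendsto_pi_of_tendsto_integral_prod {ι E : Type*} [MetricSpace E] [MeasurableSpace E]
    [BorelSpace E] [SecondCountableTopology E] {L : Filter ι} [L.IsCountablyGenerated]
    {m : ℕ} (ν : Measure E) [IsProbabilityMeasure ν] {μs : ι → ProbabilityMeasure (Fin m → E)}
    (h : ∀ f : Fin m → E →ᵇ ℝ, Tendsto (fun i ↦ ∫ x, ∏ k, f k (x k) ∂(μs i : Measure (Fin m → E)))
      L (𝓝 (∏ k, ∫ x, f k x ∂ν))) :
    Tendsto μs L (𝓝 ⟨Measure.pi fun _ ↦ ν, inferInstance⟩) := by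
  let S : Set (Set (Fin m → E)) := {t | ∃ s : Fin m → Set E, t = univ.pi s ∧
    (∀ k, MeasurableSet (s k)) ∧ (∀ k, ν (frontier (s k)) = 0)}
  have hS : IsPiSystem S := by
    rintro - ⟨s, rfl, smeas, hs⟩ - ⟨s', rfl, s'meas, hs'⟩ -
    exact ⟨fun k ↦ s k ∩ s' k, pi_inter_distrib.symm, fun k ↦ (smeas k).inter (s'meas k),
      fun k ↦ null_frontier_inter (hs k) (hs' k)⟩
  refine hS.tendsto_probabilityMeasure_of_tendsto_of_mem ?_ ?_ ?_
  · rintro - ⟨s, rfl, smeas, hs⟩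
    exact MeasurableSet.univ_pi smeas
  · intro u u_open x xu
    obtain ⟨ε, εpos, hε⟩ : ∃ ε > 0, Metric.ball x ε ⊆ u := Metric.isOpen_iff.1 u_open x xu
    have A : ∀ k, ∃ r ∈ Ioo 0 ε, ν (frontier (Metric.thickening r {x k})) = 0 := fun k ↦
      exists_null_frontier_thickening _ _ εpos
    choose! r rpos hr using A
    refine ⟨univ.pi (fun k ↦ Metric.ball (x k) (r k)), ⟨fun k ↦ Metric.ball (x k) (r k), rfl,
      fun k ↦ measurableSet_ball, fun k ↦ by simpa using hr k⟩, ?_, ?_⟩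
    · apply IsOpen.mem_nhds
      · exact isOpen_set_pi finite_univ (by simp)
      · simpa using fun k ↦ (rpos k).1
    · calc univ.pi fun k ↦ Metric.ball (x k) (r k)
      _ ⊆ univ.pi fun k ↦ Metric.ball (x k) ε :=
          pi_mono fun k _ ↦ Metric.ball_subset_ball (rpos k).2.le
      _ ⊆ u := by rwa [← ball_pi _ εpos]
  · rintro - ⟨s, rfl, smeas, hs⟩
    -- sandwich the indicator of the box between products of continuous functions
    rw [← NNReal.tendsto_coe]
    change Tendsto (fun i ↦ (μs i : Measure (Fin m → E)).real (univ.pi s)) L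
      (𝓝 ((Measure.pi fun _ ↦ ν).real (univ.pi s)))
    have hval : (Measure.pi fun _ : Fin m ↦ ν).real (univ.pi s) = ∏ k, ν.real (s k) := by
      simp [measureReal_def, Measure.pi_pi, ENNReal.toReal_prod]
    rw [hval]
    -- continuous approximations from above of the indicator of a closed set
    have happ : ∀ A : Set E, IsClosed A → ∃ g : ℕ → E →ᵇ ℝ, (∀ n x, 0 ≤ g n x ∧ g n x ≤ 1) ∧
        (∀ n, ∀ x ∈ A, g n x = 1) ∧ Tendsto (fun n ↦ ∫ x, g n x ∂ν) atTop (𝓝 (ν.real A)) := by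
      intro A hA
      have hle : ∀ n x, hA.apprSeq n x ≤ 1 := HasOuterApproxClosed.apprSeq_apply_le_one hA
      refine ⟨fun n ↦ BoundedContinuousFunction.ofNormedAddCommGroup
        (fun x ↦ (hA.apprSeq n x : ℝ)) (by fun_prop) 1 fun x ↦ by simpa using hle n x,
        fun n x ↦ ⟨NNReal.coe_nonneg _, by simpa using hle n x⟩,
        fun n x hx ↦ by simpa using HasOuterApproxClosed.apprSeq_apply_eq_one hA n hx, ?_⟩
      rw [← integral_indicator_one hA.measurableSet]
      refine tendsto_integral_of_dominated_convergence (fun _ ↦ 1)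
        (fun n ↦ (map_continuous _).measurable.aestronglyMeasurable) (integrable_const _)
        (fun n ↦ .of_forall fun x ↦ by simpa using hle n x) (.of_forall fun x ↦ ?_)
      have h1 := tendsto_pi_nhds.1 (HasOuterApproxClosed.tendsto_apprSeq hA) x
      rw [← NNReal.tendsto_coe] at h1
      refine (h1.congr fun n ↦ rfl).trans_eq ?_
      by_cases hx : x ∈ A <;> simp [hx]
    choose! g hg01 hg1 hglim using happ
    have hsub : ∀ (f : E →ᵇ ℝ), ∫ x, (1 - f) x ∂ν = 1 - ∫ x, f x ∂ν := fun f ↦ by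
      simp only [BoundedContinuousFunction.coe_sub, BoundedContinuousFunction.coe_one,
        Pi.sub_apply, Pi.one_apply]
      rw [integral_sub (integrable_const _) (f.integrable ν)]
      simp
    have hint : ∀ (f : Fin m → E →ᵇ ℝ), (∀ k x, 0 ≤ f k x ∧ f k x ≤ 1) → ∀ i,
        Integrable (fun x : Fin m → E ↦ ∏ k, f k (x k)) (μs i : Measure (Fin m → E)) :=
      fun f hf i ↦ Integrable.of_bound (Finset.measurable_fun_prod _ fun k _ ↦
        (f k).continuous.measurable.comp (measurable_pi_apply k)).aestronglyMeasurable 1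
        (.of_forall fun x ↦ by
          rw [Real.norm_of_nonneg (Finset.prod_nonneg fun k _ ↦ (hf k _).1)]
          exact Finset.prod_le_one (fun k _ ↦ (hf k _).1) fun k _ ↦ (hf k _).2)
    have hbox : MeasurableSet (univ.pi s) := MeasurableSet.univ_pi smeas
    have hclos : ∀ k, ν.real (closure (s k)) = ν.real (s k) := fun k ↦
      measureReal_congr (closure_ae_eq_of_null_frontier (hs k))
    have hintr : ∀ k, ν.real (interior (s k)) = ν.real (s k) := fun k ↦
      measureReal_congr (interior_ae_eq_of_null_frontier (hs k))
    rw [tendsto_order]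
    constructor
    · -- from below, through the interiors of the sides
      intro a ha
      set f : ℕ → Fin m → E →ᵇ ℝ := fun n k ↦ 1 - g (interior (s k))ᶜ n with hf
      have hcl : ∀ k, IsClosed (interior (s k))ᶜ := fun k ↦ isOpen_interior.isClosed_compl
      have hf01 : ∀ n k x, 0 ≤ f n k x ∧ f n k x ≤ 1 := fun n k x ↦ by
        have := hg01 _ (hcl k) n x
        simp only [hf, BoundedContinuousFunction.coe_sub, BoundedContinuousFunction.coe_one,
          Pi.sub_apply, Pi.one_apply]
        constructor <;> linarith
      have hl : Tendsto (fun n ↦ ∏ k, ∫ x, f n k x ∂ν) atTop (𝓝 (∏ k, ν.real (s k))) := by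
        refine tendsto_finsetProd _ fun k _ ↦ ?_
        simp only [hf, hsub]
        rw [← hintr k, ← compl_compl (interior (s k)),
          probReal_compl_eq_one_sub (hcl k).measurableSet, compl_compl]
        exact (hglim _ (hcl k)).const_sub 1
      obtain ⟨n, hn⟩ := (hl.eventually_const_lt ha).exists
      filter_upwards [(h (f n)).eventually_const_lt hn] with i hi
      refine hi.trans_le ?_
      rw [← integral_indicator_one hbox]
      refine integral_mono (hint _ (hf01 n) i) ((integrable_const _).indicator hbox) fun x ↦ ?_
      by_cases hx : x ∈ univ.pi s
      · rw [indicator_of_mem hx]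
        exact Finset.prod_le_one (fun k _ ↦ (hf01 n k _).1) fun k _ ↦ (hf01 n k _).2
      · rw [indicator_of_notMem hx]
        simp only [mem_univ_pi, not_forall] at hx
        obtain ⟨k, hk⟩ := hx
        refine (Finset.prod_eq_zero (Finset.mem_univ k) ?_).le
        simp [hf, hg1 _ (hcl k) n (x k) fun h ↦ hk (interior_subset h)]
    · -- from above, through their closures
      intro a ha
      have hl : Tendsto (fun n ↦ ∏ k, ∫ x, g (closure (s k)) n x ∂ν) atTop
          (𝓝 (∏ k, ν.real (s k))) := by
        refine tendsto_finsetProd _ fun k _ ↦ ?_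
        rw [← hclos k]
        exact hglim _ isClosed_closure
      obtain ⟨n, hn⟩ := (hl.eventually_lt_const ha).exists
      have hf01 : ∀ k x, 0 ≤ g (closure (s k)) n x ∧ g (closure (s k)) n x ≤ 1 := fun k x ↦
        hg01 _ isClosed_closure n x
      filter_upwards [(h fun k ↦ g (closure (s k)) n).eventually_lt_const hn] with i hi
      refine lt_of_le_of_lt ?_ hi
      rw [← integral_indicator_one hbox]
      refine integral_mono ((integrable_const _).indicator hbox) (hint _ hf01 i) fun x ↦ ?_
      by_cases hx : x ∈ univ.pi s
      · rw [indicator_of_mem hx]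
        refine (Finset.prod_eq_one fun k _ ↦ ?_).ge
        exact hg1 _ isClosed_closure n _ (subset_closure (hx k (mem_univ k)))
      · rw [indicator_of_notMem hx]
        exact Finset.prod_nonneg fun k _ ↦ (hf01 k _).1

end Product

/-- The processes are evaluated at `(α i * t + β i).toNNReal`, which is `α i * t + β i` for all
large `t`. -/
theorem corollary1 {Ω E : Type*} [MeasurableSpace Ω] [MetricSpace E] [MeasurableSpace E]
    [BorelSpace E] (P : Measure Ω) [IsProbabilityMeasure P]
    (X : ℝ≥0 → Ω → E) (C : ℕ → ℝ≥0 → Ω → E) (T : ℕ → Ω → ℝ)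
    (hX : IsRegenerative P X C T)
    (hT_nonarith : ¬ IsArithmetic (P.map (T 0)))
    (hT_int : Integrable (T 0) P) (hT_pos : 0 < ∫ ω, T 0 ω ∂P)
    (m : ℕ) (α β : Fin m → ℝ) (hα_pos : ∀ i, 0 < α i) (hα_inj : ∀ i j, i ≠ j → α i ≠ α j) :
    AsymptoticallyIID P (fun i t ω ↦ X (α i * t + β i).toNNReal ω) := by
  have hν := hX.isProbabilityMeasure_stationaryLaw hT_int hT_pos
  have hlim := hX.tendsto_integral_prod hT_nonarith hT_int hT_pos hα_pos hα_inj (β := β)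
  refine ⟨stationaryLaw P C T, hν, fun i t ↦ hX.aemeasurable_apply _, hlim, fun {_} ↦ ?_⟩
  have hm : ∀ t : ℝ, AEMeasurable (fun ω (i : Fin m) ↦ X (α i * t + β i).toNNReal ω) P := fun t ↦
    aemeasurable_pi_lambda _ fun i ↦ hX.aemeasurable_apply _
  refine ⟨hm, aemeasurable_id, ?_⟩
  simp_rw [Measure.map_id]
  refine tendsto_pi_of_tendsto_integral_prod _ fun f ↦ (hlim f).congr fun t ↦ ?_
  exact (integral_map (hm t) (Finset.measurable_fun_prod _ fun k _ ↦
    (f k).continuous.measurable.comp (measurable_pi_apply k)).aestronglyMeasurable).symm
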